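/- Let $\beta\ge 2$ and $M\ge 1$, and consider $N\ge M+\beta-1$ qubits $q_1,\dots,q_N$. A *ladder ansatz with block size $\beta$* is a parametrized quantum circuit $\mathbf U(\theta)=B_M\cdots B_2B_1$ whose $k$-th block $B_k$ acts on the $\beta$ consecutive qubits $s(B_k)=\{q_k,\dots,q_{k+\beta-1}\}$ and is a product of gates $e^{-i\theta_\nu\Omega_\nu}$ with Hermitian generators $\Omega_\nu$ on $s(B_k)$ and one real parameter $\theta_\nu$ per gate. The parameters are random. Let $U_\mu=e^{-i\theta_\mu\Omega_\mu}$ be a gate of the block $B_{k(\mu)}=R\,U_\mu L$, where $\Omega_\mu$ is a non-identity Pauli string on $s(B_{k(\mu)})$ and $L$, $R$ are the products of the gates of that block preceding and following $U_\mu$. Assume that the blocks $B_k$ with $k\ne k(\mu)$ are unitary $2$-designs on $s(B_k)$, that $L$ and $R$ are unitary $2$-designs on $s(B_{k(\mu)})$, and that the $B_k$ ($k\neq k(\mu)$), $L$, $U_\mu$, $R$ are mutually independent. Let $H=\sum_j\lambda_j h_j$ with $\lambda_j\in\mathbb R$ and finitely many pairwise distinct, non-identity Pauli strings $h_j$ on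 the $N$ qubits, whose supports $s(h_j)$ (the qubits on which $h_j$ is not the identity) satisfy $|s(h_j)|\le r$ and $s(h_j)\subseteq\bigcup_k s(B_k)$. Let $C(\theta)=\langle 0\cdots0|\,\mathbf U(\theta)^\dagger H\,\mathbf U(\theta)\,|0\cdots0\rangle$ and $\partial_\mu C=\partial C/\partial\theta_\mu$. For each $j$ let $k'(j)$ be the largest $k$ with $s(B_k)\cap s(h_j)\ne\varnothing$, and put $\Delta_{\mu j}=k'(j)-k(\mu)$. Then $$\operatorname{Var}[\partial_\mu C]\;\ge\;\sum_{j:\;k'(j)\ge k(\mu)}\lambda_j^2\;2^{\,1-2\beta(\Delta_{\mu j}+r)} .$$ -/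

import Mathlib

open MeasureTheory ProbabilityTheory
open scoped Matrix Kronecker

noncomputable section

/-! ### Unitary designs -/

/-- The measurable structure on complex matrices generated by the entries. -/
instance matrixMeasurableSpace {m n : Type*} : MeasurableSpace (Matrix m n ℂ) :=
  inferInstanceAs (MeasurableSpace (m → n → ℂ))

instance matrixBorelSpace {m n : Type*} [Fintype m] [Fintype n] : BorelSpace (Matrix m n ℂ) :=
  inferInstanceAs (BorelSpace (m → n → ℂ))

instance unitaryGroupCompactSpace {n : Type*} [Fintype n] [DecidableEq n] :
    CompactSpace (Matrix.unitaryGroup n ℂ) := by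
  refine isCompact_iff_compactSpace.mp ?_
  have hK : IsCompact (Set.pi Set.univ (fun _ : n => Set.pi Set.univ
      (fun _ : n => Metric.closedBall (0 : ℂ) 1))) :=
    isCompact_univ_pi fun _ => isCompact_univ_pi fun _ => isCompact_closedBall 0 1
  have hcl : IsClosed ((Matrix.unitaryGroup n ℂ : Submonoid (Matrix n n ℂ)) :
      Set (Matrix n n ℂ)) := isClosed_unitary
  refine IsCompact.of_isClosed_subset (X := Matrix n n ℂ) hK hcl ?_
  intro U hU i _ j _
  simpa using entry_norm_bound_of_unitary hU i j

/-- The normalized Haar measure on the unitary group. -/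
def unitaryHaar (n : Type*) [Fintype n] [DecidableEq n] : Measure (Matrix.unitaryGroup n ℂ) :=
  Measure.haarMeasure ⊤

/-- The twirled matrix `(V ⊗ V)ᴴ A (V ⊗ V)` on two copies of the system. -/
def doubleConj {n : Type*} [Fintype n] (V : Matrix n n ℂ) (A : Matrix (n × n) (n × n) ℂ) :
    Matrix (n × n) (n × n) ℂ :=
  (V ⊗ₖ V)ᴴ * A * (V ⊗ₖ V)

/-- A random matrix `V` is a unitary 2-design: it is unitary, and its second-order twirling channel
`A ↦ 𝔼[(V ⊗ V)ᴴ A (V ⊗ V)]` (computed entrywise) coincides with that of the Haar measure. -/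
def IsTwoDesign {Ω n : Type*} [MeasurableSpace Ω] [Fintype n] [DecidableEq n]
    (P : Measure Ω) (V : Ω → Matrix n n ℂ) : Prop :=
  (∀ ω, V ω ∈ Matrix.unitaryGroup n ℂ) ∧
    ∀ (A : Matrix (n × n) (n × n) ℂ) (x y : n × n),
      ∫ ω, doubleConj (V ω) A x y ∂P
        = ∫ U : Matrix.unitaryGroup n ℂ, doubleConj (U : Matrix n n ℂ) A x y ∂(unitaryHaar n)

/-! ### Qubits and Pauli strings -/

/-- Matrices acting on the qubits labelled by `Q`, in the computational basis `Q → Fin 2`. -/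
abbrev QubitMatrix (Q : Type*) := Matrix (Q → Fin 2) (Q → Fin 2) ℂ

inductive Pauli
  | I | X | Y | Z
  deriving DecidableEq

/-- The 2 × 2 Pauli matrices. -/
def Pauli.toMatrix : Pauli → Matrix (Fin 2) (Fin 2) ℂ
  | .I => !![1, 0; 0, 1]
  | .X => !![0, 1; 1, 0]
  | .Y => !![0, -Complex.I; Complex.I, 0]
  | .Z => !![1, 0; 0, -1]

/-- The tensor product of the Pauli matrices `p q`, over the qubits `q`. -/
def pauliString {Q : Type*} [Fintype Q] (p : Q → Pauli) : QubitMatrix Q :=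
  fun x y => ∏ q, (p q).toMatrix (x q) (y q)

/-- The qubits on which a Pauli string is not the identity. -/
def pauliSupport {Q : Type*} [Fintype Q] (p : Q → Pauli) : Finset Q :=
  Finset.univ.filter fun q => p q ≠ Pauli.I

/-- The operator on all `N` qubits that acts as `A` on the qubits in `s` and as the identity on
the others. -/
def extendById {N : ℕ} (s : Finset (Fin N)) (A : QubitMatrix s) : QubitMatrix (Fin N) :=
  fun x y => if ∀ q, q ∉ s → x q = y q then A (fun q => x q) (fun q => y q) else 0

/-! ### Parametrized circuits -/

/-- A parametrized circuit on `N` qubits whose gates are grouped into `M` successive blocks, the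
`k`-th of which acts on the qubits in `supp k`. Block `k` consists of `numGates k` successive
gates, and gate `a` of block `k` is `exp (-i θ Ω)` with `Ω = gen k a` Hermitian. -/
structure BlockCircuit {N M : ℕ} (supp : Fin M → Finset (Fin N)) where
  numGates : Fin M → ℕ
  gen : (k : Fin M) → Fin (numGates k) → QubitMatrix (supp k)
  gen_isHermitian : ∀ k a, (gen k a).IsHermitian

namespace BlockCircuit

variable {N M : ℕ} {supp : Fin M → Finset (Fin N)} (C : BlockCircuit supp)

/-- There is one real parameter for each gate. -/
abbrev Params := (Σ k : Fin M, Fin (C.numGates k)) → ℝ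

/-- The gate `a` of the block `k`. -/
def gate (θ : C.Params) (k : Fin M) (a : Fin (C.numGates k)) : QubitMatrix (supp k) :=
  NormedSpace.exp ((-Complex.I * (θ ⟨k, a⟩ : ℂ)) • C.gen k a)

/-- The product of all gates of the block `k`, later gates standing to the left. -/
def block (θ : C.Params) (k : Fin M) : QubitMatrix (supp k) :=
  (List.ofFn (C.gate θ k)).reverse.prod

/-- The product of the gates of the block `k` that precede the gate `a`. -/
def before (θ : C.Params) (k : Fin M) (a : Fin (C.numGates k)) : QubitMatrix (supp k) :=
  ((List.ofFn (C.gate θ k)).take a).reverse.prod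

/-- The product of the gates of the block `k` that follow the gate `a`. -/
def after (θ : C.Params) (k : Fin M) (a : Fin (C.numGates k)) : QubitMatrix (supp k) :=
  ((List.ofFn (C.gate θ k)).drop (a + 1)).reverse.prod

/-- The unitary of the whole circuit: the product of all blocks, later blocks to the left. -/
def unitary (θ : C.Params) : QubitMatrix (Fin N) :=
  (List.ofFn fun k => extendById (supp k) (C.block θ k)).reverse.prod

/-- The energy expectation `⟨0…0| Uᴴ H U |0…0⟩`. -/
def cost (H : QubitMatrix (Fin N)) (θ : C.Params) : ℝ :=
  (((C.unitary θ)ᴴ * H * C.unitary θ) (fun _ => 0) (fun _ => 0)).re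

/-- The partial derivative of the cost with respect to the parameter of gate `a` of block `k`. -/
def costDeriv (H : QubitMatrix (Fin N)) (k : Fin M) (a : Fin (C.numGates k)) (θ : C.Params) : ℝ :=
  deriv (fun t : ℝ => C.cost H (Function.update θ ⟨k, a⟩ t)) (θ ⟨k, a⟩)

/-- The pieces into which the circuit is cut by the differential gate `a` of block `κ`: the other
blocks, and within block `κ` the gates before `a`, the gate `a` itself, and the gates after `a`. -/
def pieces (κ : Fin M) (a : Fin (C.numGates κ)) :
    {k : Fin M // k ≠ κ} ⊕ Fin 3 → C.Params → QubitMatrix (Fin N)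
  | .inl k, θ => extendById (supp k) (C.block θ k)
  | .inr 0, θ => extendById (supp κ) (C.before θ κ a)
  | .inr 1, θ => extendById (supp κ) (C.gate θ κ a)
  | .inr 2, θ => extendById (supp κ) (C.after θ κ a)

end BlockCircuit

/-- The ladder layout: the `k`-th block acts on the `β` consecutive qubits `k, …, k + β - 1`
(blocks and qubits both counted from `0`), so each block is shifted by one qubit from the
previous one. -/
def ladder (N M β : ℕ) (k : Fin M) : Finset (Fin N) :=
  Finset.univ.filter fun q => (k : ℕ) ≤ q ∧ (q : ℕ) < k + β

end

noncomputable section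

/-! ### Two copies of a system -/

section Twirl

variable {Ω n : Type*} [MeasurableSpace Ω] [Fintype n]

/-! The derivative has mean zero, so its variance is its second moment, which is an entry ⟨00|·|00⟩
on two copies of the system. In the Heisenberg picture the derivative arises by conjugating `H` with
the part of the circuit from the differential gate on, taking i[Ω, ·], and conjugating with the part
before it (`costDeriv_eq`). By independence, the expectation of its square is a composition of one
channel per block, the last block acting first, applied to `H ⊗ H` (`integral_eq_channelValue`,
`integral_costDeriv_sq`).

The twirl of a two-design does not change when its argument is rotated by a fixed unitary. Rotations
built from Pauli strings show that p ⊗ q is annihilated when p ≠ q, and that all p ⊗ p with p ≠ I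
have the same image, namely the average of t ⊗ t over the 4^β - 1 non-trivial strings t
(`IsTwoDesign.twirl_pauliString`). The block cut by the differential gate acts in the same way up to
the factor 2·4^β/(4^β - 1), except that it annihilates strings that are trivial on the block
(`isPauliMixing_of_cut`). Hence distinct terms of `H` do not interfere
(`LadderValue.eq_zero_of_ne`), and each diagonal term is a sum over paths of a walk on Pauli strings
with nonnegative weights.

A diagonal term is therefore at least the weight of any single path that ends in a string of I's and
Z's, whose expectation in |0…0⟩ is 1. With w = 4^(-β), an active block has weight at least w, the
active differential block at least 2w, and an inactive other block has weight 1. From `k'` down to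
the differential block, each block is collapsed to Z on its first qubit: since β ≥ 2 this qubit lies
in the preceding block, which becomes active, and the qubits below κ stay untouched. From the
differential block on, each active block is collapsed to Z on its last qubit, which no earlier block
touches, so that each further active block uses up one of the at most r - 1 support qubits below κ.
At most Δ + 1 + (r - 1) blocks are active, and the weight is at least 2w^(Δ+r)
(`LadderValue.two_mul_pow_le`). -/

theorem doubleConj_mul (V W : Matrix n n ℂ) (A : Matrix (n × n) (n × n) ℂ) :
    doubleConj (V * W) A = doubleConj W (doubleConj V A) := by
  simp [doubleConj, Matrix.mul_kronecker_mul, Matrix.conjTranspose_mul, Matrix.mul_assoc]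

theorem doubleConj_kronecker (V A B : Matrix n n ℂ) :
    doubleConj V (A ⊗ₖ B) = (Vᴴ * A * V) ⊗ₖ (Vᴴ * B * V) := by
  simp [doubleConj, Matrix.mul_kronecker_mul, Matrix.conjTranspose_kronecker]

theorem doubleConj_apply (V : Matrix n n ℂ) (A : Matrix (n × n) (n × n) ℂ) (x y : n × n) :
    doubleConj V A x y
      = ∑ u, ∑ v, star ((V ⊗ₖ V) u x) * (V ⊗ₖ V) v y * A u v := by
  simp only [doubleConj, Matrix.mul_apply, Matrix.conjTranspose_apply, Finset.sum_mul]
  rw [Finset.sum_comm]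
  exact Finset.sum_congr rfl fun u _ => Finset.sum_congr rfl fun v _ => by ring

theorem continuous_doubleConj_apply (A : Matrix (n × n) (n × n) ℂ) (x y : n × n) :
    Continuous fun V : Matrix n n ℂ => doubleConj V A x y := by
  simp only [doubleConj_apply, Matrix.kroneckerMap_apply]
  fun_prop

/-- The second-order twirling channel `A ↦ 𝔼[(V ⊗ V)ᴴ A (V ⊗ V)]` of a random matrix. -/
def twirl (P : Measure Ω) (V : Ω → Matrix n n ℂ) :
    Matrix (n × n) (n × n) ℂ →ₗ[ℂ] Matrix (n × n) (n × n) ℂ where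
  -- Written through second moments, the channel is linear without any integrability assumption;
  -- `twirl_apply` recovers the integral.
  toFun A := Matrix.of fun x y =>
    ∑ u, ∑ v, (∫ ω, star ((V ω ⊗ₖ V ω) u x) * (V ω ⊗ₖ V ω) v y ∂P) * A u v
  map_add' A B := by
    ext x y
    simp [mul_add, Finset.sum_add_distrib]
  map_smul' c A := by
    ext x y
    simp only [Matrix.smul_apply, Matrix.of_apply, smul_eq_mul, RingHom.id_apply, Finset.mul_sum]
    exact Finset.sum_congr rfl fun u _ => Finset.sum_congr rfl fun v _ => by ring

variable [DecidableEq n]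

theorem isCompact_unitaryGroup :
    IsCompact ((Matrix.unitaryGroup n ℂ : Submonoid (Matrix n n ℂ)) : Set (Matrix n n ℂ)) :=
  isCompact_iff_compactSpace.mpr unitaryGroupCompactSpace

/-- A continuous function of a random unitary matrix is integrable. -/
theorem integrable_comp_of_unitary {P : Measure Ω} [IsFiniteMeasure P] {V : Ω → Matrix n n ℂ}
    (hm : Measurable V) (hu : ∀ ω, V ω ∈ Matrix.unitaryGroup n ℂ)
    {F : Matrix n n ℂ → ℂ} (hF : Continuous F) : Integrable (fun ω => F (V ω)) P := by
  obtain ⟨c, hc⟩ := isCompact_unitaryGroup.exists_bound_of_continuousOn hF.continuousOn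
  exact Integrable.of_bound (hF.measurable.comp hm).aestronglyMeasurable c
    (Filter.Eventually.of_forall fun ω => hc _ (hu ω))

theorem twirl_apply {P : Measure Ω} [IsFiniteMeasure P] {V : Ω → Matrix n n ℂ}
    (hm : Measurable V) (hu : ∀ ω, V ω ∈ Matrix.unitaryGroup n ℂ)
    (A : Matrix (n × n) (n × n) ℂ) (x y : n × n) :
    twirl P V A x y = ∫ ω, doubleConj (V ω) A x y ∂P := by
  have hint : ∀ u v, Integrable
      (fun ω => star ((V ω ⊗ₖ V ω) u x) * (V ω ⊗ₖ V ω) v y * A u v) P := by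
    intro u v
    refine integrable_comp_of_unitary hm hu
      (F := fun V => star ((V ⊗ₖ V) u x) * (V ⊗ₖ V) v y * A u v) ?_
    simp only [Matrix.kroneckerMap_apply]
    fun_prop
  simp only [doubleConj_apply]
  rw [integral_finsetSum _ fun u _ => integrable_finsetSum _ fun v _ => hint u v]
  refine Finset.sum_congr rfl fun u _ => ?_
  rw [integral_finsetSum _ fun v _ => hint u v]
  exact Finset.sum_congr rfl fun v _ => (integral_mul_const _ _).symm

/-- Averages over independent unitaries factor, also with a fixed linear map in between. -/
theorem integral_doubleConj_comp {P : Measure Ω} [IsProbabilityMeasure P]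
    {V W : Ω → Matrix n n ℂ} (hVm : Measurable V) (hVu : ∀ ω, V ω ∈ Matrix.unitaryGroup n ℂ)
    (hWm : Measurable W) (hWu : ∀ ω, W ω ∈ Matrix.unitaryGroup n ℂ) (hind : IndepFun V W P)
    (D : Matrix (n × n) (n × n) ℂ →ₗ[ℂ] Matrix (n × n) (n × n) ℂ)
    (A : Matrix (n × n) (n × n) ℂ) (x y : n × n) :
    ∫ ω, doubleConj (W ω) (D (doubleConj (V ω) A)) x y ∂P = twirl P W (D (twirl P V A)) x y := by
  -- Expanding in matrix units makes the entries of `D B` finite linear combinations of those of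
  -- `B`; this gives continuity and lets `D` commute with the expectation.
  have hD : ∀ (B : Matrix (n × n) (n × n) ℂ) (u v : n × n),
      D B u v = ∑ a, ∑ b, B a b * D (Matrix.single a b 1) u v := by
    intro B u v
    conv_lhs => rw [Matrix.matrix_eq_sum_single B]
    simp only [map_sum, Matrix.sum_apply]
    refine Finset.sum_congr rfl fun a _ => Finset.sum_congr rfl fun b _ => ?_
    rw [← mul_one (B a b), ← smul_eq_mul, ← Matrix.smul_single, map_smul]
    simp
  have hF : ∀ u v, Continuous fun U : Matrix n n ℂ => star ((U ⊗ₖ U) u x) * (U ⊗ₖ U) v y := by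
    intro u v
    simp only [Matrix.kroneckerMap_apply]
    fun_prop
  have hG : ∀ u v, Continuous fun U : Matrix n n ℂ => D (doubleConj U A) u v := by
    intro u v
    simp only [hD (doubleConj _ A)]
    exact continuous_finsetSum _ fun a _ => continuous_finsetSum _ fun b _ =>
      (continuous_doubleConj_apply A a b).mul continuous_const
  have hi : ∀ u v, IndepFun (fun ω => star ((W ω ⊗ₖ W ω) u x) * (W ω ⊗ₖ W ω) v y)
      (fun ω => D (doubleConj (V ω) A) u v) P := fun u v =>
    hind.symm.comp (hF u v).measurable (hG u v).measurable
  have hiF : ∀ u v, Integrable (fun ω => star ((W ω ⊗ₖ W ω) u x) * (W ω ⊗ₖ W ω) v y) P :=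
    fun u v => integrable_comp_of_unitary hWm hWu (hF u v)
  have hiG : ∀ u v, Integrable (fun ω => D (doubleConj (V ω) A) u v) P :=
    fun u v => integrable_comp_of_unitary hVm hVu (hG u v)
  have hint : ∀ u v, Integrable (fun ω => star ((W ω ⊗ₖ W ω) u x) * (W ω ⊗ₖ W ω) v y
      * D (doubleConj (V ω) A) u v) P := fun u v => (hi u v).integrable_mul (hiF u v) (hiG u v)
  have hDE : ∀ u v, ∫ ω, D (doubleConj (V ω) A) u v ∂P = D (twirl P V A) u v := by
    intro u v
    have h1 : ∀ a b, Integrable (fun ω => doubleConj (V ω) A a b * D (Matrix.single a b 1) u v) P :=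
      fun a b => (integrable_comp_of_unitary hVm hVu (continuous_doubleConj_apply A a b)).mul_const _
    simp only [hD (doubleConj _ A)]
    rw [hD (twirl P V A), integral_finsetSum _ fun a _ => integrable_finsetSum _ fun b _ => h1 a b]
    refine Finset.sum_congr rfl fun a _ => ?_
    rw [integral_finsetSum _ fun b _ => h1 a b]
    refine Finset.sum_congr rfl fun b _ => ?_
    rw [integral_mul_const, twirl_apply hVm hVu]
  simp only [doubleConj_apply (W _)]
  rw [integral_finsetSum _ fun u _ => integrable_finsetSum _ fun v _ => hint u v]
  refine Finset.sum_congr rfl fun u _ => ?_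
  rw [integral_finsetSum _ fun v _ => hint u v]
  refine Finset.sum_congr rfl fun v _ => ?_
  rw [← hDE u v]
  exact (hi u v).integral_mul_eq_mul_integral (hiF u v).aestronglyMeasurable
    (hiG u v).aestronglyMeasurable

/-- Observables evolve in the Heisenberg picture: the left factor, which acts last on states, is
averaged first. -/
theorem twirl_mul {P : Measure Ω} [IsProbabilityMeasure P]
    {V W : Ω → Matrix n n ℂ} (hVm : Measurable V) (hVu : ∀ ω, V ω ∈ Matrix.unitaryGroup n ℂ)
    (hWm : Measurable W) (hWu : ∀ ω, W ω ∈ Matrix.unitaryGroup n ℂ) (hind : IndepFun V W P)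
    (hm : Measurable fun ω => V ω * W ω) (A : Matrix (n × n) (n × n) ℂ) :
    twirl P (fun ω => V ω * W ω) A = twirl P W (twirl P V A) := by
  ext x y
  rw [twirl_apply hm (fun ω => mul_mem (hVu ω) (hWu ω))]
  simp only [doubleConj_mul]
  exact integral_doubleConj_comp hVm hVu hWm hWu hind LinearMap.id A x y

theorem twirl_eq_of_forall {P : Measure Ω} [IsProbabilityMeasure P] {V : Ω → Matrix n n ℂ}
    (hm : Measurable V) (hu : ∀ ω, V ω ∈ Matrix.unitaryGroup n ℂ)
    {A B : Matrix (n × n) (n × n) ℂ} (h : ∀ ω, doubleConj (V ω) A = B) : twirl P V A = B := by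
  ext x y
  rw [twirl_apply hm hu]
  simp [h]

theorem doubleConj_one {V : Matrix n n ℂ} (hV : V ∈ Matrix.unitaryGroup n ℂ) :
    doubleConj V 1 = 1 := by
  have h : Vᴴ * V = 1 := Matrix.mem_unitaryGroup_iff'.mp hV
  rw [← Matrix.one_kronecker_one, doubleConj_kronecker]
  simp [h]

theorem twirl_one {P : Measure Ω} [IsProbabilityMeasure P] {V : Ω → Matrix n n ℂ}
    (hm : Measurable V) (hu : ∀ ω, V ω ∈ Matrix.unitaryGroup n ℂ) : twirl P V 1 = 1 :=
  twirl_eq_of_forall hm hu fun ω => doubleConj_one (hu ω)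

/-- The operator that exchanges two copies of a system. -/
def swapMatrix (n : Type*) [DecidableEq n] : Matrix (n × n) (n × n) ℂ :=
  fun x y => if x.1 = y.2 ∧ x.2 = y.1 then 1 else 0

theorem mul_swapMatrix (A : Matrix (n × n) (n × n) ℂ) (x y : n × n) :
    (A * swapMatrix n) x y = A x y.swap := by
  rw [Matrix.mul_apply, Finset.sum_eq_single y.swap]
  · simp [swapMatrix]
  · rintro ⟨b1, b2⟩ - hb
    rw [swapMatrix, if_neg, mul_zero]
    rintro ⟨h1, h2⟩
    exact hb (Prod.ext h1 h2)
  · simp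

theorem swapMatrix_mul (A : Matrix (n × n) (n × n) ℂ) (x y : n × n) :
    (swapMatrix n * A) x y = A x.swap y := by
  rw [Matrix.mul_apply, Finset.sum_eq_single x.swap]
  · simp [swapMatrix]
  · rintro ⟨b1, b2⟩ - hb
    rw [swapMatrix, if_neg, zero_mul]
    rintro ⟨h1, h2⟩
    exact hb (Prod.ext h2.symm h1.symm)
  · simp

theorem swapMatrix_mul_self : swapMatrix n * swapMatrix n = 1 := by
  ext x y
  rw [swapMatrix_mul]
  obtain ⟨x1, x2⟩ := x
  obtain ⟨y1, y2⟩ := y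
  simp [swapMatrix, Matrix.one_apply, and_comm]

theorem kronecker_mul_swapMatrix (A B : Matrix n n ℂ) :
    (A ⊗ₖ B) * swapMatrix n = swapMatrix n * (B ⊗ₖ A) := by
  ext x y
  rw [mul_swapMatrix, swapMatrix_mul]
  simp [mul_comm]

/-- The swap commutes with `V ⊗ V`. This is what later evaluates the twirl of `(G ⊗ G)` times the
swap. -/
theorem doubleConj_mul_swapMatrix (V : Matrix n n ℂ) (A : Matrix (n × n) (n × n) ℂ) :
    doubleConj V (A * swapMatrix n) = doubleConj V A * swapMatrix n := by
  simp only [doubleConj, Matrix.mul_assoc, kronecker_mul_swapMatrix]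

theorem twirl_mul_swapMatrix {P : Measure Ω} [IsProbabilityMeasure P] {V : Ω → Matrix n n ℂ}
    (hm : Measurable V) (hu : ∀ ω, V ω ∈ Matrix.unitaryGroup n ℂ)
    (A : Matrix (n × n) (n × n) ℂ) : twirl P V (A * swapMatrix n) = twirl P V A * swapMatrix n := by
  ext x y
  rw [mul_swapMatrix, twirl_apply hm hu, twirl_apply hm hu]
  simp only [doubleConj_mul_swapMatrix, mul_swapMatrix]

theorem doubleConj_swapMatrix {V : Matrix n n ℂ} (hV : V ∈ Matrix.unitaryGroup n ℂ) :
    doubleConj V (swapMatrix n) = swapMatrix n := by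
  have h := doubleConj_mul_swapMatrix V 1
  rwa [one_mul, doubleConj_one hV, one_mul] at h

theorem twirl_swapMatrix {P : Measure Ω} [IsProbabilityMeasure P] {V : Ω → Matrix n n ℂ}
    (hm : Measurable V) (hu : ∀ ω, V ω ∈ Matrix.unitaryGroup n ℂ) :
    twirl P V (swapMatrix n) = swapMatrix n :=
  twirl_eq_of_forall hm hu fun ω => doubleConj_swapMatrix (hu ω)

instance : IsProbabilityMeasure (unitaryHaar n) where
  measure_univ := by
    have h := Measure.haarMeasure_self (K₀ := (⊤ : TopologicalSpace.PositiveCompacts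
      (Matrix.unitaryGroup n ℂ)))
    simpa [unitaryHaar] using h

instance : (unitaryHaar n).IsMulLeftInvariant := by
  unfold unitaryHaar
  infer_instance

/-- The twirl of a two-design does not see a fixed rotation of its argument. -/
theorem IsTwoDesign.twirl_doubleConj {P : Measure Ω} [IsProbabilityMeasure P]
    {V : Ω → Matrix n n ℂ} (hV : IsTwoDesign P V) (hm : Measurable V) {W : Matrix n n ℂ}
    (hW : W ∈ Matrix.unitaryGroup n ℂ) (A : Matrix (n × n) (n × n) ℂ) :
    twirl P V (doubleConj W A) = twirl P V A := by
  ext x y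
  rw [twirl_apply hm hV.1, twirl_apply hm hV.1, hV.2, hV.2]
  have h := integral_mul_left_eq_self (μ := unitaryHaar n)
    (fun U : Matrix.unitaryGroup n ℂ => doubleConj (U : Matrix n n ℂ) A x y) ⟨W, hW⟩
  simpa [doubleConj_mul] using h

end Twirl

/-! ### The algebra of Pauli strings -/

instance : Fintype Pauli where
  elems := {.I, .X, .Y, .Z}
  complete p := by cases p <;> decide

/-- The sign with which two single-qubit Pauli matrices commute. -/
def Pauli.sign (a b : Pauli) : ℂ := if a = .I ∨ b = .I ∨ a = b then 1 else -1

theorem Pauli.toMatrix_mul_comm (a b : Pauli) :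
    a.toMatrix * b.toMatrix = a.sign b • (b.toMatrix * a.toMatrix) := by
  cases a <;> cases b <;> ext i j <;> fin_cases i <;> fin_cases j <;>
    simp [Pauli.toMatrix, Pauli.sign]

theorem Pauli.toMatrix_mul_self (a : Pauli) : a.toMatrix * a.toMatrix = 1 := by
  cases a <;> ext i j <;> fin_cases i <;> fin_cases j <;> simp [Pauli.toMatrix]

theorem Pauli.toMatrix_conjTranspose (a : Pauli) : a.toMatrixᴴ = a.toMatrix := by
  cases a <;> ext i j <;> fin_cases i <;> fin_cases j <;> simp [Pauli.toMatrix]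

theorem Pauli.toMatrix_I : Pauli.I.toMatrix = 1 := by
  ext i j; fin_cases i <;> fin_cases j <;> simp [Pauli.toMatrix]

/-- The completeness relation of the Pauli matrices. Taken over all qubits, it expresses the swap of
two copies through the squares t ⊗ t. -/
theorem Pauli.sum_toMatrix_mul_toMatrix (i j k l : Fin 2) :
    ∑ a : Pauli, a.toMatrix i j * a.toMatrix k l = if i = l ∧ k = j then 2 else 0 := by
  have h : (Finset.univ : Finset Pauli) = {.I, .X, .Y, .Z} := rfl
  rw [h]
  fin_cases i <;> fin_cases j <;> fin_cases k <;> fin_cases l <;>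
    simp [Pauli.toMatrix] <;> norm_num

theorem Pauli.exists_sign_ne {a b : Pauli} (h : a ≠ b) :
    ∃ c : Pauli, a.sign c * b.sign c = -1 := by
  -- The signs are complex numbers, so the finite check is made on the decidable condition that
  -- defines them.
  have key : ∃ c : Pauli, ¬ ((a = .I ∨ c = .I ∨ a = c) ↔ (b = .I ∨ c = .I ∨ b = c)) := by
    revert a b; decide
  obtain ⟨c, hc⟩ := key
  refine ⟨c, ?_⟩
  unfold Pauli.sign
  by_cases h1 : a = .I ∨ c = .I ∨ a = c <;> by_cases h2 : b = .I ∨ c = .I ∨ b = c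
  · exact absurd (iff_of_true h1 h2) hc
  · rw [if_pos h1, if_neg h2, one_mul]
  · rw [if_neg h1, if_pos h2, mul_one]
  · exact absurd (iff_of_false h1 h2) hc

theorem Pauli.exists_sign_eq_neg_one {a b : Pauli} (ha : a ≠ .I) (hb : b ≠ .I) :
    ∃ c : Pauli, a.sign c = -1 ∧ b.sign c = -1 := by
  have key : ∃ c : Pauli, ¬ (a = .I ∨ c = .I ∨ a = c) ∧ ¬ (b = .I ∨ c = .I ∨ b = c) := by
    revert a b; decide
  obtain ⟨c, h1, h2⟩ := key
  exact ⟨c, if_neg h1, if_neg h2⟩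

section PauliString

variable {Q : Type*} [Fintype Q]

theorem pauliString_apply (p : Q → Pauli) (x y : Q → Fin 2) :
    pauliString p x y = ∏ i, (p i).toMatrix (x i) (y i) := rfl

theorem pauliString_conjTranspose (p : Q → Pauli) : (pauliString p)ᴴ = pauliString p := by
  ext x y
  rw [Matrix.conjTranspose_apply, pauliString_apply, pauliString_apply, star_prod]
  refine Finset.prod_congr rfl fun i _ => ?_
  rw [← Matrix.conjTranspose_apply, Pauli.toMatrix_conjTranspose]

theorem prod_one_apply (x y : Q → Fin 2) :
    ∏ i, (1 : Matrix (Fin 2) (Fin 2) ℂ) (x i) (y i) = (1 : QubitMatrix Q) x y := by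
  by_cases h : x = y
  · rw [h, Matrix.one_apply_eq]
    exact Finset.prod_eq_one fun i _ => Matrix.one_apply_eq _
  · obtain ⟨i, hi⟩ := Function.ne_iff.mp h
    rw [Matrix.one_apply_ne h]
    exact Finset.prod_eq_zero (Finset.mem_univ i) (Matrix.one_apply_ne hi)

theorem pauliString_I : pauliString (fun _ : Q => Pauli.I) = 1 := by
  ext x y
  simp only [pauliString_apply, Pauli.toMatrix_I, prod_one_apply]

variable [DecidableEq Q]

theorem pauliString_mul_apply (p q : Q → Pauli) (x y : Q → Fin 2) :
    (pauliString p * pauliString q) x y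
      = ∏ i, ((p i).toMatrix * (q i).toMatrix) (x i) (y i) := by
  simp only [Matrix.mul_apply, pauliString_apply, ← Finset.prod_mul_distrib]
  rw [Finset.prod_univ_sum, Fintype.piFinset_univ]

theorem pauliString_mul_comm (p q : Q → Pauli) :
    pauliString p * pauliString q
      = (∏ i, (p i).sign (q i)) • (pauliString q * pauliString p) := by
  ext x y
  rw [Matrix.smul_apply, pauliString_mul_apply, pauliString_mul_apply, smul_eq_mul,
    ← Finset.prod_mul_distrib]
  refine Finset.prod_congr rfl fun i _ => ?_
  rw [Pauli.toMatrix_mul_comm, Matrix.smul_apply, smul_eq_mul]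

theorem pauliString_mul_self (p : Q → Pauli) : pauliString p * pauliString p = 1 := by
  ext x y
  simp only [pauliString_mul_apply, Pauli.toMatrix_mul_self, prod_one_apply]

theorem pauliString_mem_unitaryGroup (p : Q → Pauli) :
    pauliString p ∈ Matrix.unitaryGroup (Q → Fin 2) ℂ := by
  rw [Matrix.mem_unitaryGroup_iff', Matrix.star_eq_conjTranspose, pauliString_conjTranspose,
    pauliString_mul_self]

/-- Conjugation of a Pauli string by another one only changes its sign. -/
theorem pauliString_conj (w p : Q → Pauli) :
    (pauliString w)ᴴ * pauliString p * pauliString w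
      = (∏ i, (p i).sign (w i)) • pauliString p := by
  rw [pauliString_conjTranspose, Matrix.mul_assoc, pauliString_mul_comm, Matrix.mul_smul,
    ← Matrix.mul_assoc, pauliString_mul_self, Matrix.one_mul]

theorem sum_pauliString_kronecker :
    ∑ t : Q → Pauli, pauliString t ⊗ₖ pauliString t
      = (2 ^ Fintype.card Q : ℂ) • swapMatrix (Q → Fin 2) := by
  ext x y
  simp only [Matrix.sum_apply, Matrix.kroneckerMap_apply, pauliString_apply,
    ← Finset.prod_mul_distrib, Matrix.smul_apply, smul_eq_mul]
  rw [← Fintype.piFinset_univ, ← Finset.prod_univ_sum (fun _ : Q => (Finset.univ : Finset Pauli))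
    (fun i a => a.toMatrix (x.1 i) (y.1 i) * a.toMatrix (x.2 i) (y.2 i))]
  simp only [Pauli.sum_toMatrix_mul_toMatrix, swapMatrix]
  by_cases h : x.1 = y.2 ∧ x.2 = y.1
  · simp [h.1, h.2]
  · rw [if_neg h, mul_zero]
    have : ∃ i, ¬ (x.1 i = y.2 i ∧ x.2 i = y.1 i) := by
      by_contra hc
      push Not at hc
      exact h ⟨funext fun i => (hc i).1, funext fun i => (hc i).2⟩
    obtain ⟨i, hi⟩ := this
    exact Finset.prod_eq_zero (Finset.mem_univ i) (if_neg hi)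

theorem Pauli.sign_I (a : Pauli) : a.sign .I = 1 := by simp [Pauli.sign]

theorem Pauli.I_sign (a : Pauli) : Pauli.I.sign a = 1 := by simp [Pauli.sign]

theorem prod_sign_update (p w : Q → Pauli) (i : Q) (c : Pauli) (hw : w i = .I) :
    ∏ j, (p j).sign (Function.update w i c j) = (p i).sign c * ∏ j, (p j).sign (w j) := by
  rw [← Finset.mul_prod_erase _ _ (Finset.mem_univ i),
    ← Finset.mul_prod_erase (Finset.univ) (fun j => (p j).sign (w j)) (Finset.mem_univ i), hw,
    Pauli.sign_I, one_mul, Function.update_self]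
  congr 1
  refine Finset.prod_congr rfl fun j hj => ?_
  rw [Function.update_of_ne (Finset.ne_of_mem_erase hj)]

/-- Distinct Pauli strings are told apart by the sign with which a third one commutes. -/
theorem exists_pauliString_sign_ne {p q : Q → Pauli} (h : p ≠ q) :
    ∃ w : Q → Pauli, (∏ i, (p i).sign (w i)) * (∏ i, (q i).sign (w i)) = -1 := by
  obtain ⟨i, hi⟩ := Function.ne_iff.mp h
  obtain ⟨c, hc⟩ := Pauli.exists_sign_ne hi
  refine ⟨Function.update (fun _ => Pauli.I) i c, ?_⟩
  rw [prod_sign_update _ _ _ _ rfl, prod_sign_update _ _ _ _ rfl]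
  simpa [Pauli.sign_I] using hc

/-- Two non-trivial Pauli strings have a common anticommuting one. -/
theorem exists_pauliString_anticomm {p q : Q → Pauli} (hp : p ≠ fun _ => .I)
    (hq : q ≠ fun _ => .I) :
    ∃ w : Q → Pauli, (∏ i, (p i).sign (w i)) = -1 ∧ (∏ i, (q i).sign (w i)) = -1 := by
  -- On a common support qubit a single Pauli matrix anticommutes with both strings. If the supports
  -- are disjoint, one qubit is taken from each.
  by_cases h : ∃ i, p i ≠ .I ∧ q i ≠ .I
  · obtain ⟨i, h1, h2⟩ := h
    obtain ⟨c, hc1, hc2⟩ := Pauli.exists_sign_eq_neg_one h1 h2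
    refine ⟨Function.update (fun _ => Pauli.I) i c, ?_, ?_⟩ <;>
      rw [prod_sign_update _ _ _ _ rfl] <;> simp [Pauli.sign_I, hc1, hc2]
  · push Not at h
    obtain ⟨i, hi⟩ := Function.ne_iff.mp hp
    obtain ⟨j, hj⟩ := Function.ne_iff.mp hq
    have hqi : q i = .I := h i hi
    have hpj : p j = .I := by
      by_contra hc
      exact hj (h j hc)
    have hij : i ≠ j := fun e => hi (e ▸ hpj)
    obtain ⟨c, hc, -⟩ := Pauli.exists_sign_eq_neg_one hi hi
    obtain ⟨d, hd, -⟩ := Pauli.exists_sign_eq_neg_one hj hj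
    refine ⟨Function.update (Function.update (fun _ => Pauli.I) i c) j d, ?_, ?_⟩ <;>
      rw [prod_sign_update _ _ _ _ (by rw [Function.update_of_ne hij.symm]),
        prod_sign_update _ _ _ _ rfl] <;>
      simp [Pauli.sign_I, Pauli.I_sign, hc, hd, hqi, hpj]

end PauliString

/-! ### Twirling Pauli strings -/

section TwirlPauli

variable {Ω Q : Type*} [MeasurableSpace Ω] [Fintype Q] [DecidableEq Q]
  {P : Measure Ω} [IsProbabilityMeasure P] {V : Ω → QubitMatrix Q}

/-- A Pauli string `w` that anticommutes with exactly one of `p`, `q` flips the sign of p ⊗ q under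
conjugation, so the twirl equals its own negative. -/
theorem IsTwoDesign.twirl_pauliString_ne (hV : IsTwoDesign P V) (hm : Measurable V)
    {p q : Q → Pauli} (h : p ≠ q) : twirl P V (pauliString p ⊗ₖ pauliString q) = 0 := by
  obtain ⟨w, hw⟩ := exists_pauliString_sign_ne h
  have h1 := hV.twirl_doubleConj hm (pauliString_mem_unitaryGroup w)
    (pauliString p ⊗ₖ pauliString q)
  rw [doubleConj_kronecker, pauliString_conj, pauliString_conj, Matrix.smul_kronecker,
    Matrix.kronecker_smul, smul_smul, hw, neg_one_smul, map_neg] at h1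
  have h2 : (2 : ℂ) • twirl P V (pauliString p ⊗ₖ pauliString q) = 0 := by
    rw [two_smul]
    nth_rewrite 1 [← h1]
    exact neg_add_cancel _
  exact (smul_eq_zero.mp h2).resolve_left two_ne_zero

/-- For anticommuting `p` and `r`, the operator (p + r)/√2 is unitary and conjugates `p` into `r`,
as the Hadamard gate does with X and Z. -/
theorem IsTwoDesign.twirl_pauliString_anticomm (hV : IsTwoDesign P V) (hm : Measurable V)
    {p r : Q → Pauli} (h : ∏ i, (p i).sign (r i) = -1) :
    twirl P V (pauliString p ⊗ₖ pauliString p) = twirl P V (pauliString r ⊗ₖ pauliString r) := by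
  set A := pauliString p
  set B := pauliString r
  have hA : A * A = 1 := pauliString_mul_self p
  have hB : B * B = 1 := pauliString_mul_self r
  have hAB : A * B = -(B * A) := by
    have := pauliString_mul_comm p r
    rwa [h, neg_one_smul] at this
  set c : ℂ := ((Real.sqrt 2 / 2 : ℝ) : ℂ)
  have hc : c * c = 1 / 2 := by
    rw [← Complex.ofReal_mul]
    have : Real.sqrt 2 / 2 * (Real.sqrt 2 / 2) = 1 / 2 := by
      have := Real.mul_self_sqrt (show (0 : ℝ) ≤ 2 by norm_num)
      linarith
    rw [this]; norm_num
  have hWs : (c • (A + B))ᴴ = c • (A + B) := by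
    rw [Matrix.conjTranspose_smul, Matrix.conjTranspose_add, pauliString_conjTranspose,
      pauliString_conjTranspose, Complex.star_def, Complex.conj_ofReal]
  have hW : c • (A + B) ∈ Matrix.unitaryGroup (Q → Fin 2) ℂ := by
    rw [Matrix.mem_unitaryGroup_iff', Matrix.star_eq_conjTranspose, hWs, smul_mul_smul_comm, hc]
    simp only [add_mul, mul_add, hA, hB, hAB]
    rw [show (1 : QubitMatrix Q) + B * A + (-(B * A) + 1) = (2 : ℂ) • 1 by rw [two_smul]; abel,
      smul_smul]
    norm_num
  have hconj : (c • (A + B))ᴴ * A * (c • (A + B)) = B := by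
    have h3 : B * (B * A) = A := by rw [← mul_assoc, hB, one_mul]
    have h4 : A * (B * A) = -B := by
      rw [← mul_assoc, hAB, neg_mul, mul_assoc, hA, mul_one]
    rw [hWs, smul_mul_assoc, smul_mul_smul_comm, hc]
    simp only [add_mul, mul_add, hA, mul_assoc, hAB, h3, mul_neg, mul_one, one_mul]
    rw [show A + B + (B + -A) = (2 : ℂ) • B by rw [two_smul]; abel, smul_smul]
    norm_num
  have h1 := hV.twirl_doubleConj hm hW (A ⊗ₖ A)
  rw [doubleConj_kronecker, hconj] at h1
  exact h1.symm

/-- Two non-trivial strings need not anticommute, but both are linked to a string that anticommutes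
with each. -/
theorem IsTwoDesign.twirl_pauliString_eq (hV : IsTwoDesign P V) (hm : Measurable V)
    {p q : Q → Pauli} (hp : p ≠ fun _ => .I) (hq : q ≠ fun _ => .I) :
    twirl P V (pauliString p ⊗ₖ pauliString p) = twirl P V (pauliString q ⊗ₖ pauliString q) := by
  obtain ⟨w, h1, h2⟩ := exists_pauliString_anticomm hp hq
  rw [hV.twirl_pauliString_anticomm hm h1, hV.twirl_pauliString_anticomm hm h2]

theorem sum_nontrivial_pauliString_kronecker :
    ∑ t : {t : Q → Pauli // t ≠ fun _ => .I}, pauliString t.1 ⊗ₖ pauliString t.1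
      = (2 ^ Fintype.card Q : ℂ) • swapMatrix (Q → Fin 2) - 1 := by
  rw [← sum_pauliString_kronecker, eq_sub_iff_add_eq,
    ← Finset.add_sum_erase Finset.univ _ (Finset.mem_univ (fun _ : Q => Pauli.I)), pauliString_I,
    Matrix.one_kronecker_one, add_comm]
  congr 1
  exact (Finset.sum_subtype (Finset.univ.erase fun _ : Q => Pauli.I)
    (fun t => by simp) fun t => pauliString t ⊗ₖ pauliString t).symm

theorem card_nontrivial_pauli :
    (Fintype.card {t : Q → Pauli // t ≠ fun _ => .I} : ℂ) = (4 : ℂ) ^ Fintype.card Q - 1 := by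
  rw [Fintype.card_subtype_compl, Fintype.card_subtype_eq]
  have h4 : Fintype.card Pauli = 4 := rfl
  rw [Fintype.card_fun, h4, Nat.cast_sub (Nat.one_le_pow _ _ (by norm_num))]
  simp

theorem four_pow_card_sub_one_ne_zero {p : Q → Pauli} (hp : p ≠ fun _ => .I) :
    (4 : ℂ) ^ Fintype.card Q - 1 ≠ 0 := by
  rw [← card_nontrivial_pauli]
  have : Nonempty {t : Q → Pauli // t ≠ fun _ => .I} := ⟨⟨p, hp⟩⟩
  exact_mod_cast Fintype.card_ne_zero

/-- All 4^n - 1 non-trivial squares share one twirl, and their sum, 2^n times the swap minus the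
identity, is fixed by the twirl; division by the number of terms gives the formula. -/
theorem IsTwoDesign.twirl_pauliString (hV : IsTwoDesign P V) (hm : Measurable V)
    {p : Q → Pauli} (hp : p ≠ fun _ => .I) :
    twirl P V (pauliString p ⊗ₖ pauliString p)
      = ((4 : ℂ) ^ Fintype.card Q - 1)⁻¹ • ((2 ^ Fintype.card Q : ℂ) • swapMatrix (Q → Fin 2) - 1) := by
  have h := congrArg (twirl P V) (sum_nontrivial_pauliString_kronecker (Q := Q))
  rw [map_sum, Finset.sum_congr rfl fun t _ => hV.twirl_pauliString_eq hm t.2 hp,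
    Finset.sum_const, map_sub, map_smul, twirl_swapMatrix hm hV.1, twirl_one hm hV.1,
    Finset.card_univ, ← Nat.cast_smul_eq_nsmul ℂ, card_nontrivial_pauli] at h
  rw [← h, smul_smul, inv_mul_cancel₀ (four_pow_card_sub_one_ne_zero hp), one_smul]

end TwirlPauli

/-! ### The commutator with the generator of a gate -/

/-- The linear map `A ↦ i (B A - A B)`. -/
def commutatorMap {m : Type*} [Fintype m] [DecidableEq m] (B : Matrix m m ℂ) :
    Matrix m m ℂ →ₗ[ℂ] Matrix m m ℂ :=
  Complex.I • (LinearMap.mulLeft ℂ B - LinearMap.mulRight ℂ B)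

theorem commutatorMap_apply {m : Type*} [Fintype m] [DecidableEq m] (B A : Matrix m m ℂ) :
    commutatorMap B A = Complex.I • (B * A - A * B) := rfl

section DoubleCommutator

variable {n : Type*} [Fintype n] [DecidableEq n]

/-- The commutator with `G` on both copies of a system. -/
def doubleCommutator (G : Matrix n n ℂ) :
    Matrix (n × n) (n × n) ℂ →ₗ[ℂ] Matrix (n × n) (n × n) ℂ :=
  commutatorMap (G ⊗ₖ 1) ∘ₗ commutatorMap (1 ⊗ₖ G)

theorem commutatorMap_fst_kronecker (G A B : Matrix n n ℂ) :
    commutatorMap (G ⊗ₖ 1) (A ⊗ₖ B) = commutatorMap G A ⊗ₖ B := by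
  simp only [commutatorMap_apply, ← Matrix.mul_kronecker_mul, Matrix.one_mul, Matrix.mul_one,
    Matrix.smul_kronecker]
  rw [sub_eq_add_neg (G * A), Matrix.add_kronecker, ← neg_one_smul ℂ (A * G),
    Matrix.smul_kronecker, neg_one_smul, ← sub_eq_add_neg]

theorem commutatorMap_snd_kronecker (G A B : Matrix n n ℂ) :
    commutatorMap (1 ⊗ₖ G) (A ⊗ₖ B) = A ⊗ₖ commutatorMap G B := by
  simp only [commutatorMap_apply, ← Matrix.mul_kronecker_mul, Matrix.one_mul, Matrix.mul_one,
    Matrix.kronecker_smul]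
  rw [sub_eq_add_neg (G * B), Matrix.kronecker_add, ← neg_one_smul ℂ (B * G),
    Matrix.kronecker_smul, neg_one_smul, ← sub_eq_add_neg]

theorem doubleCommutator_kronecker (G A B : Matrix n n ℂ) :
    doubleCommutator G (A ⊗ₖ B) = commutatorMap G A ⊗ₖ commutatorMap G B := by
  rw [doubleCommutator, LinearMap.comp_apply, commutatorMap_snd_kronecker,
    commutatorMap_fst_kronecker]

theorem doubleCommutator_one (G : Matrix n n ℂ) : doubleCommutator G 1 = 0 := by
  rw [← Matrix.one_kronecker_one, doubleCommutator_kronecker]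
  simp [commutatorMap_apply]

/-- The swap carries `G ⊗ 1` into `1 ⊗ G`, so the four terms of the double commutator pair up; `G *
G = 1` turns one pair into the bare swap. -/
theorem doubleCommutator_swapMatrix {G : Matrix n n ℂ} (hG : G * G = 1) :
    doubleCommutator G (swapMatrix n) = (2 : ℂ) • ((1 - G ⊗ₖ G) * swapMatrix n) := by
  have h1 : swapMatrix n * (1 ⊗ₖ G) = (G ⊗ₖ 1) * swapMatrix n :=
    (kronecker_mul_swapMatrix _ _).symm
  have h2 : swapMatrix n * (G ⊗ₖ 1) = (1 ⊗ₖ G) * swapMatrix n :=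
    (kronecker_mul_swapMatrix _ _).symm
  have h3 : (G ⊗ₖ (1 : Matrix n n ℂ)) * (1 ⊗ₖ G) = G ⊗ₖ G := by
    rw [← Matrix.mul_kronecker_mul, Matrix.mul_one, Matrix.one_mul]
  have h4 : ((1 : Matrix n n ℂ) ⊗ₖ G) * (1 ⊗ₖ G) = 1 := by
    rw [← Matrix.mul_kronecker_mul, Matrix.mul_one, hG, Matrix.one_kronecker_one]
  have h5 : (G ⊗ₖ (1 : Matrix n n ℂ)) * (G ⊗ₖ 1) = 1 := by
    rw [← Matrix.mul_kronecker_mul, Matrix.mul_one, hG, Matrix.one_kronecker_one]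
  rw [doubleCommutator, LinearMap.comp_apply, commutatorMap_apply (1 ⊗ₖ G), map_smul,
    commutatorMap_apply, smul_smul, Complex.I_mul_I, h1]
  simp only [mul_sub, sub_mul, Matrix.mul_assoc, h2]
  simp only [← Matrix.mul_assoc, h3, h4, h5, Matrix.one_mul]
  rw [two_smul, neg_one_smul]
  abel

/-- The commutator map of a gate conjugated into the middle of a circuit, in expectation. -/
theorem IsTwoDesign.twirl_doubleCommutator {Ω Q : Type*} [MeasurableSpace Ω] [Fintype Q]
    [DecidableEq Q] {P : Measure Ω} [IsProbabilityMeasure P] {L U R : Ω → QubitMatrix Q}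
    (hL : IsTwoDesign P L) (hLm : Measurable L)
    (hU : ∀ ω, U ω ∈ Matrix.unitaryGroup (Q → Fin 2) ℂ) (hUm : Measurable U)
    (hR : IsTwoDesign P R) (hRm : Measurable R) {g p : Q → Pauli} (hg : g ≠ fun _ => .I)
    (hp : p ≠ fun _ => .I) :
    twirl P L (doubleCommutator (pauliString g)
        (twirl P U (twirl P R (pauliString p ⊗ₖ pauliString p))))
      = (2 * (4 : ℂ) ^ Fintype.card Q / ((4 : ℂ) ^ Fintype.card Q - 1)) •
        twirl P L (pauliString p ⊗ₖ pauliString p) := by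
  have hne := four_pow_card_sub_one_ne_zero hp
  have h4 : (4 : ℂ) ^ Fintype.card Q = 2 ^ Fintype.card Q * 2 ^ Fintype.card Q := by
    rw [← mul_pow]; norm_num
  -- After `R` only the identity and the swap remain, and `U` fixes both. The double commutator
  -- kills the identity and sends the swap S to 2(1 - G ⊗ G)S; the average over `L` then brings in
  -- the twirl of G ⊗ G, which is again explicit.
  rw [hR.twirl_pauliString hRm hp, hL.twirl_pauliString hLm hp]
  simp only [map_smul, map_sub, twirl_swapMatrix hUm hU, twirl_one hUm hU, doubleCommutator_one,
    doubleCommutator_swapMatrix (pauliString_mul_self g), sub_zero,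
    twirl_mul_swapMatrix hLm hL.1, twirl_one hLm hL.1, hL.twirl_pauliString hLm hg]
  rw [sub_mul, one_mul, smul_mul_assoc, sub_mul, smul_mul_assoc, swapMatrix_mul_self, one_mul]
  ext x y
  simp only [Matrix.smul_apply, Matrix.sub_apply, smul_eq_mul]
  rw [h4] at hne ⊢
  generalize (2 : ℂ) ^ Fintype.card Q = d at hne ⊢
  have h5 : (d * d - 1)⁻¹ * (d * d - 1) = 1 := inv_mul_cancel₀ hne
  rw [div_eq_mul_inv]
  generalize (d * d - 1)⁻¹ = c at h5 ⊢
  generalize swapMatrix (Q → Fin 2) x y = S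
  linear_combination (-2 * d * c * S) * h5

end DoubleCommutator

/-! ### Operators on a part of the qubits -/

section Extend

variable {N : ℕ} (s : Finset (Fin N))

/-- Splitting a basis state into its parts on `s` and on the other qubits. -/
def qubitSplit : (Fin N → Fin 2) ≃ (s → Fin 2) × ({q // q ∉ s} → Fin 2) :=
  Equiv.piEquivPiSubtypeProd (fun q => q ∈ s) fun _ => Fin 2

/-- The operator that acts as `A` on `s` and as `B` on the other qubits. -/
def splitTensor (A : QubitMatrix s) (B : QubitMatrix {q // q ∉ s}) : QubitMatrix (Fin N) :=
  (A ⊗ₖ B).submatrix (qubitSplit s) (qubitSplit s)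

theorem splitTensor_mul (A A' : QubitMatrix s) (B B' : QubitMatrix {q // q ∉ s}) :
    splitTensor s A B * splitTensor s A' B' = splitTensor s (A * A') (B * B') := by
  rw [splitTensor, splitTensor, Matrix.submatrix_mul_equiv, ← Matrix.mul_kronecker_mul, splitTensor]

theorem splitTensor_conjTranspose (A : QubitMatrix s) (B : QubitMatrix {q // q ∉ s}) :
    (splitTensor s A B)ᴴ = splitTensor s Aᴴ Bᴴ := by
  rw [splitTensor, Matrix.conjTranspose_submatrix, Matrix.conjTranspose_kronecker, splitTensor]

theorem splitTensor_one : splitTensor s 1 1 = 1 := by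
  rw [splitTensor, Matrix.one_kronecker_one, Matrix.submatrix_one_equiv]

theorem extendById_eq_splitTensor (A : QubitMatrix s) :
    extendById s A = splitTensor s A 1 := by
  ext x y
  have h : (qubitSplit s x).2 = (qubitSplit s y).2 ↔ ∀ q, q ∉ s → x q = y q :=
    ⟨fun h q hq => congrFun h ⟨q, hq⟩, fun h => funext fun q => h q.1 q.2⟩
  simp only [extendById, splitTensor, Matrix.submatrix_apply, Matrix.kroneckerMap_apply,
    Matrix.one_apply, h, mul_ite, mul_one, mul_zero]
  rfl

theorem pauliString_eq_splitTensor (p : Fin N → Pauli) :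
    pauliString p = splitTensor s (pauliString fun q : s => p q)
      (pauliString fun q : {q // q ∉ s} => p q) := by
  ext x y
  simp only [splitTensor, Matrix.submatrix_apply, Matrix.kroneckerMap_apply, pauliString_apply]
  rw [← Fintype.prod_subtype_mul_prod_subtype (fun q => q ∈ s)
    fun q => (p q).toMatrix (x q) (y q)]
  congr 1
  exact Finset.prod_congr (by ext; simp) fun _ _ => rfl

theorem extendById_mul (A B : QubitMatrix s) :
    extendById s (A * B) = extendById s A * extendById s B := by
  simp only [extendById_eq_splitTensor, splitTensor_mul, Matrix.one_mul]

theorem extendById_one : extendById s 1 = 1 := by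
  rw [extendById_eq_splitTensor, splitTensor_one]

theorem extendById_conjTranspose (A : QubitMatrix s) :
    (extendById s A)ᴴ = extendById s Aᴴ := by
  simp only [extendById_eq_splitTensor, splitTensor_conjTranspose, Matrix.conjTranspose_one]

theorem extendById_mem_unitaryGroup {A : QubitMatrix s}
    (hA : A ∈ Matrix.unitaryGroup (s → Fin 2) ℂ) :
    extendById s A ∈ Matrix.unitaryGroup (Fin N → Fin 2) ℂ := by
  rw [Matrix.mem_unitaryGroup_iff', Matrix.star_eq_conjTranspose] at hA ⊢
  rw [extendById_conjTranspose, ← extendById_mul, hA, extendById_one]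

theorem continuous_extendById : Continuous (extendById s) := by
  refine continuous_matrix fun x y => ?_
  by_cases h : ∀ q, q ∉ s → x q = y q
  · simp only [extendById, if_pos h]
    fun_prop
  · simp only [extendById, if_neg h]
    fun_prop

/-- An operator on two copies of `s`, tensored with a product operator on the other qubits. -/
def liftDouble (B B' : QubitMatrix {q // q ∉ s}) :
    Matrix ((s → Fin 2) × (s → Fin 2)) ((s → Fin 2) × (s → Fin 2)) ℂ →ₗ[ℂ]
      Matrix ((Fin N → Fin 2) × (Fin N → Fin 2)) ((Fin N → Fin 2) × (Fin N → Fin 2)) ℂ where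
  toFun A := Matrix.of fun x y =>
    A ((qubitSplit s x.1).1, (qubitSplit s x.2).1) ((qubitSplit s y.1).1, (qubitSplit s y.2).1)
      * (B (qubitSplit s x.1).2 (qubitSplit s y.1).2 * B' (qubitSplit s x.2).2 (qubitSplit s y.2).2)
  map_add' A A' := by
    ext x y
    simp [add_mul]
  map_smul' c A := by
    ext x y
    simp [mul_assoc]

theorem liftDouble_apply (B B' : QubitMatrix {q // q ∉ s})
    (A : Matrix ((s → Fin 2) × (s → Fin 2)) ((s → Fin 2) × (s → Fin 2)) ℂ)
    (x y : (Fin N → Fin 2) × (Fin N → Fin 2)) :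
    liftDouble s B B' A x y =
    A ((qubitSplit s x.1).1, (qubitSplit s x.2).1) ((qubitSplit s y.1).1, (qubitSplit s y.2).1)
      * (B (qubitSplit s x.1).2 (qubitSplit s y.1).2
        * B' (qubitSplit s x.2).2 (qubitSplit s y.2).2) := rfl

theorem liftDouble_kronecker (B B' : QubitMatrix {q // q ∉ s}) (A A' : QubitMatrix s) :
    liftDouble s B B' (A ⊗ₖ A') = splitTensor s A B ⊗ₖ splitTensor s A' B' := by
  ext x y
  simp only [liftDouble_apply, splitTensor, Matrix.kroneckerMap_apply, Matrix.submatrix_apply]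
  ring

/-- Matrix units of the doubled system are Kronecker products of matrix units, so product operators
span. Identities involving `liftDouble` are checked on products in this way. -/
theorem linearMap_ext_kronecker {m E : Type*} [Fintype m] [DecidableEq m] [AddCommMonoid E]
    [Module ℂ E] {f g : Matrix (m × m) (m × m) ℂ →ₗ[ℂ] E}
    (h : ∀ A B : Matrix m m ℂ, f (A ⊗ₖ B) = g (A ⊗ₖ B)) : f = g := by
  refine LinearMap.ext fun X => ?_
  induction X using Matrix.induction_on' with
  | h_zero => rw [map_zero, map_zero]
  | h_add A B hA hB => rw [map_add, map_add, hA, hB]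
  | h_std_basis i j c =>
    have := h (Matrix.single i.1 j.1 c) (Matrix.single i.2 j.2 1)
    rwa [Matrix.single_kronecker_single, mul_one] at this

/-- `doubleConj` as a linear map. -/
def doubleConjMap {m : Type*} [Fintype m] (V : Matrix m m ℂ) :
    Matrix (m × m) (m × m) ℂ →ₗ[ℂ] Matrix (m × m) (m × m) ℂ where
  toFun := doubleConj V
  map_add' A B := by simp [doubleConj, mul_add, add_mul]
  map_smul' c A := by simp [doubleConj]

theorem doubleConjMap_apply {m : Type*} [Fintype m] (V : Matrix m m ℂ)
    (A : Matrix (m × m) (m × m) ℂ) : doubleConjMap V A = doubleConj V A := rfl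

theorem doubleConj_liftDouble (B B' : QubitMatrix {q // q ∉ s}) (V : QubitMatrix s)
    (A : Matrix ((s → Fin 2) × (s → Fin 2)) ((s → Fin 2) × (s → Fin 2)) ℂ) :
    doubleConj (extendById s V) (liftDouble s B B' A) = liftDouble s B B' (doubleConj V A) := by
  have : doubleConjMap (extendById s V) ∘ₗ liftDouble s B B'
      = liftDouble s B B' ∘ₗ doubleConjMap V := by
    refine linearMap_ext_kronecker fun X Y => ?_
    simp only [LinearMap.comp_apply, doubleConjMap_apply,
      liftDouble_kronecker, doubleConj_kronecker, extendById_eq_splitTensor,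
      splitTensor_conjTranspose, splitTensor_mul, Matrix.conjTranspose_one, Matrix.one_mul,
      Matrix.mul_one]
  exact LinearMap.congr_fun this A

theorem commutatorMap_extendById (G A : QubitMatrix s) (B : QubitMatrix {q // q ∉ s}) :
    commutatorMap (extendById s G) (splitTensor s A B) = splitTensor s (commutatorMap G A) B := by
  ext x y
  simp only [commutatorMap_apply, extendById_eq_splitTensor, splitTensor_mul, Matrix.one_mul,
    Matrix.mul_one]
  simp only [splitTensor, Matrix.smul_apply, Matrix.sub_apply, Matrix.submatrix_apply,
    Matrix.kroneckerMap_apply, smul_eq_mul]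
  ring

theorem doubleCommutator_liftDouble (B B' : QubitMatrix {q // q ∉ s}) (G : QubitMatrix s)
    (A : Matrix ((s → Fin 2) × (s → Fin 2)) ((s → Fin 2) × (s → Fin 2)) ℂ) :
    doubleCommutator (extendById s G) (liftDouble s B B' A)
      = liftDouble s B B' (doubleCommutator G A) := by
  have : doubleCommutator (extendById s G) ∘ₗ liftDouble s B B'
      = liftDouble s B B' ∘ₗ doubleCommutator G := by
    refine linearMap_ext_kronecker fun X Y => ?_
    simp only [LinearMap.comp_apply, liftDouble_kronecker, doubleCommutator_kronecker,
      commutatorMap_extendById]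
  exact LinearMap.congr_fun this A

theorem twirl_extendById {Ω : Type*} [MeasurableSpace Ω] {P : Measure Ω} [IsProbabilityMeasure P]
    {V : Ω → QubitMatrix s} (hm : Measurable V)
    (hu : ∀ ω, V ω ∈ Matrix.unitaryGroup (s → Fin 2) ℂ) (B B' : QubitMatrix {q // q ∉ s})
    (A : Matrix ((s → Fin 2) × (s → Fin 2)) ((s → Fin 2) × (s → Fin 2)) ℂ) :
    twirl P (fun ω => extendById s (V ω)) (liftDouble s B B' A)
      = liftDouble s B B' (twirl P V A) := by
  ext x y
  have hm' : Measurable fun ω => extendById s (V ω) := (continuous_extendById s).measurable.comp hm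
  rw [twirl_apply hm' (fun ω => extendById_mem_unitaryGroup s (hu ω)), liftDouble_apply, twirl_apply hm hu,
    ← integral_mul_const]
  simp only [doubleConj_liftDouble, liftDouble_apply]

/-- The Pauli string that agrees with `t` on `s` and with `p` on the other qubits. -/
def overwrite (p : Fin N → Pauli) (t : s → Pauli) : Fin N → Pauli :=
  fun q => if hq : q ∈ s then t ⟨q, hq⟩ else p q

theorem pauliString_overwrite (p : Fin N → Pauli) (t : s → Pauli) :
    pauliString (overwrite s p t)
      = splitTensor s (pauliString t) (pauliString fun q : {q // q ∉ s} => p q) := by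
  rw [pauliString_eq_splitTensor s]
  congr 2
  · ext q
    simp [overwrite]
  · ext q
    simp [overwrite, q.2]

theorem liftDouble_pauliString (p q : Fin N → Pauli) (t u : s → Pauli) :
    liftDouble s (pauliString fun i : {i // i ∉ s} => p i) (pauliString fun i : {i // i ∉ s} => q i)
        (pauliString t ⊗ₖ pauliString u)
      = pauliString (overwrite s p t) ⊗ₖ pauliString (overwrite s q u) := by
  rw [liftDouble_kronecker, pauliString_overwrite, pauliString_overwrite]

theorem pauliString_kronecker_eq_liftDouble (p q : Fin N → Pauli) :
    pauliString p ⊗ₖ pauliString q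
      = liftDouble s (pauliString fun i : {i // i ∉ s} => p i)
          (pauliString fun i : {i // i ∉ s} => q i)
          (pauliString (fun i : s => p i) ⊗ₖ pauliString fun i : s => q i) := by
  rw [liftDouble_kronecker, ← pauliString_eq_splitTensor, ← pauliString_eq_splitTensor]

end Extend

/-! ### The action of a block on Pauli strings -/

/-- The linear map `Φ` acts on pairs of Pauli strings as a twirled block on `s` does: pairs that
differ on `s` are annihilated, pairs that are trivial on `s` are scaled by `e`, and pairs with a
common non-trivial part on `s` have this part replaced by all non-trivial ones, with weight `c`. -/
structure IsPauliMixing {N : ℕ} (s : Finset (Fin N)) (e c : ℝ)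
    (Φ : Matrix ((Fin N → Fin 2) × (Fin N → Fin 2)) ((Fin N → Fin 2) × (Fin N → Fin 2)) ℂ →ₗ[ℂ]
      Matrix ((Fin N → Fin 2) × (Fin N → Fin 2)) ((Fin N → Fin 2) × (Fin N → Fin 2)) ℂ) :
    Prop where
  of_ne : ∀ p q : Fin N → Pauli, (∃ i ∈ s, p i ≠ q i) → Φ (pauliString p ⊗ₖ pauliString q) = 0
  of_trivial : ∀ p q : Fin N → Pauli, (∀ i ∈ s, p i = .I) → (∀ i ∈ s, q i = .I) →
    Φ (pauliString p ⊗ₖ pauliString q) = (e : ℂ) • (pauliString p ⊗ₖ pauliString q)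
  of_eq : ∀ p q : Fin N → Pauli, (∀ i ∈ s, p i = q i) → (∃ i ∈ s, p i ≠ .I) →
    Φ (pauliString p ⊗ₖ pauliString q) = (c : ℂ) • ∑ t : {t : s → Pauli // t ≠ fun _ => .I},
      pauliString (overwrite s p t) ⊗ₖ pauliString (overwrite s q t)

section Mixing

variable {Ω : Type*} [MeasurableSpace Ω] {P : Measure Ω} [IsProbabilityMeasure P]
  {N : ℕ} {s : Finset (Fin N)}

theorem restrict_ne_I {p : Fin N → Pauli} (h : ∃ i ∈ s, p i ≠ .I) :
    (fun i : s => p i) ≠ fun _ => .I := by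
  obtain ⟨i, hi, hp⟩ := h
  exact fun e => hp (congrFun e ⟨i, hi⟩)

/-- The combination of swap and identity in `IsTwoDesign.twirl_pauliString` is rewritten as the sum
of t ⊗ t over non-trivial t, which turns the channel into a step of a walk on strings. -/
theorem IsTwoDesign.isPauliMixing {V : Ω → QubitMatrix s} (hV : IsTwoDesign P V)
    (hm : Measurable V) :
    IsPauliMixing s 1 (((4 : ℝ) ^ s.card - 1)⁻¹) (twirl P fun ω => extendById s (V ω)) where
  of_ne p q h := by
    obtain ⟨i, hi, hpq⟩ := h
    rw [pauliString_kronecker_eq_liftDouble s, twirl_extendById s hm hV.1,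
      hV.twirl_pauliString_ne hm, map_zero]
    exact fun e => hpq (congrFun e ⟨i, hi⟩)
  of_trivial p q hp hq := by
    have hp' : (fun i : s => p i) = fun _ => .I := funext fun i => hp i i.2
    have hq' : (fun i : s => q i) = fun _ => .I := funext fun i => hq i i.2
    rw [pauliString_kronecker_eq_liftDouble s, twirl_extendById s hm hV.1, hp', hq',
      pauliString_I, Matrix.one_kronecker_one, twirl_one hm hV.1, Complex.ofReal_one, one_smul]
  of_eq p q hpq hp := by
    have hq' : (fun i : s => q i) = fun i : s => p i := funext fun i => (hpq i i.2).symm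
    rw [pauliString_kronecker_eq_liftDouble s, twirl_extendById s hm hV.1, hq',
      hV.twirl_pauliString hm (restrict_ne_I hp), map_smul,
      ← sum_nontrivial_pauliString_kronecker, map_sum]
    simp only [liftDouble_pauliString, Fintype.card_coe]
    push_cast
    rfl

/-- A block that is cut by a gate with generator `g` between two local designs. -/
theorem isPauliMixing_of_cut {L U R : Ω → QubitMatrix s} (hL : IsTwoDesign P L)
    (hLm : Measurable L) (hU : ∀ ω, U ω ∈ Matrix.unitaryGroup (s → Fin 2) ℂ) (hUm : Measurable U)
    (hR : IsTwoDesign P R) (hRm : Measurable R) {g : s → Pauli} (hg : g ≠ fun _ => .I) :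
    IsPauliMixing s 0 (2 * (4 : ℝ) ^ s.card / ((4 : ℝ) ^ s.card - 1) * ((4 : ℝ) ^ s.card - 1)⁻¹)
      (twirl P (fun ω => extendById s (L ω)) ∘ₗ doubleCommutator (extendById s (pauliString g)) ∘ₗ
        twirl P (fun ω => extendById s (U ω)) ∘ₗ twirl P fun ω => extendById s (R ω)) where
  of_ne p q h := by
    simp only [LinearMap.comp_apply, (hR.isPauliMixing hRm).of_ne p q h, map_zero]
  -- A string that is trivial on the block commutes with the generator; hence the weight 0 in place
  -- of 1.
  of_trivial p q hp hq := by
    have hp' : (fun i : s => p i) = fun _ => .I := funext fun i => hp i i.2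
    have hq' : (fun i : s => q i) = fun _ => .I := funext fun i => hq i i.2
    rw [pauliString_kronecker_eq_liftDouble s, hp', hq', pauliString_I, Matrix.one_kronecker_one]
    simp only [LinearMap.comp_apply, twirl_extendById s hRm hR.1, twirl_extendById s hUm hU,
      doubleCommutator_liftDouble, twirl_one hRm hR.1, twirl_one hUm hU, doubleCommutator_one,
      map_zero, Complex.ofReal_zero, zero_smul]
  of_eq p q hpq hp := by
    have hq' : (fun i : s => q i) = fun i : s => p i := funext fun i => (hpq i i.2).symm
    have hLq := (hL.isPauliMixing hLm).of_eq p q hpq hp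
    have h := hL.twirl_doubleCommutator hLm hU hUm hR hRm hg (restrict_ne_I hp)
    rw [pauliString_kronecker_eq_liftDouble s, twirl_extendById s hLm hL.1, hq'] at hLq
    rw [pauliString_kronecker_eq_liftDouble s, hq']
    simp only [LinearMap.comp_apply, twirl_extendById s hRm hR.1, twirl_extendById s hUm hU,
      twirl_extendById s hLm hL.1, doubleCommutator_liftDouble]
    rw [h, map_smul, hLq, smul_smul]
    congr 1
    rw [Fintype.card_coe]
    push_cast
    rfl

/-- A two-design annihilates or preserves a Pauli string on the first of two copies. -/
theorem IsTwoDesign.twirl_pauliString_one {V : Ω → QubitMatrix s} (hV : IsTwoDesign P V)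
    (hm : Measurable V) (p : Fin N → Pauli) :
    twirl P (fun ω => extendById s (V ω)) (pauliString p ⊗ₖ 1)
      = if ∀ i ∈ s, p i = .I then pauliString p ⊗ₖ 1 else 0 := by
  rw [← pauliString_I]
  split_ifs with h
  · simpa using (hV.isPauliMixing hm).of_trivial p (fun _ => .I) h fun _ _ => rfl
  · push Not at h
    exact (hV.isPauliMixing hm).of_ne p (fun _ => .I) h

/-- This makes the first moment vanish: the average over `R` leaves only strings that are trivial on
`s`, and these commute with every operator on `s`. -/
theorem commutator_of_cut {U R : Ω → QubitMatrix s}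
    (hU : ∀ ω, U ω ∈ Matrix.unitaryGroup (s → Fin 2) ℂ) (hUm : Measurable U)
    (hR : IsTwoDesign P R) (hRm : Measurable R) (G : QubitMatrix s) (p : Fin N → Pauli) :
    commutatorMap (extendById s G ⊗ₖ 1) (twirl P (fun ω => extendById s (U ω))
      (twirl P (fun ω => extendById s (R ω)) (pauliString p ⊗ₖ 1))) = 0 := by
  rw [hR.twirl_pauliString_one hRm]
  split_ifs with h
  · have hp' : (fun i : s => p i) = fun _ => .I := funext fun i => h i i.2
    have hU1 : twirl P (fun ω => extendById s (U ω)) (pauliString p ⊗ₖ 1)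
        = pauliString p ⊗ₖ 1 := by
      rw [← pauliString_I, pauliString_kronecker_eq_liftDouble s, twirl_extendById s hUm hU, hp']
      simp only [pauliString_I, Matrix.one_kronecker_one, twirl_one hUm hU]
    rw [hU1, commutatorMap_fst_kronecker, pauliString_eq_splitTensor s, hp', pauliString_I,
      commutatorMap_extendById]
    simp [commutatorMap_apply, splitTensor]
  · simp

end Mixing

/-! ### Random walks of Pauli strings along a ladder -/

/-- The qubits on which the first `k` blocks of a ladder act. -/
def ladderBelow (N M β k : ℕ) : Finset (Fin N) :=
  Finset.univ.filter fun i => ∃ j : Fin M, (j : ℕ) < k ∧ i ∈ ladder N M β j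

theorem mem_ladder {N M β : ℕ} {k : Fin M} {i : Fin N} :
    i ∈ ladder N M β k ↔ (k : ℕ) ≤ i ∧ (i : ℕ) < k + β := by simp [ladder]

theorem mem_ladderBelow {N M β k : ℕ} {i : Fin N} :
    i ∈ ladderBelow N M β k ↔ ∃ j : Fin M, (j : ℕ) < k ∧ i ∈ ladder N M β j := by
  simp [ladderBelow]

/-- `F k p q` is the value of the pair of Pauli strings `p`, `q` when the blocks `0, …, k - 1` of
the ladder are still to be applied. -/
structure LadderValue (N M β : ℕ) (e c : Fin M → ℝ)
    (F : ℕ → (Fin N → Pauli) → (Fin N → Pauli) → ℝ) : Prop where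
  zero_nonneg : ∀ p, 0 ≤ F 0 p p
  zero_eq_one : ∀ p, (∀ i, p i = .I ∨ p i = .Z) → F 0 p p = 1
  succ_of_ne : ∀ (k : Fin M) p q, (∃ i ∈ ladder N M β k, p i ≠ q i) → F (k + 1) p q = 0
  succ_of_trivial : ∀ (k : Fin M) p, (∀ i ∈ ladder N M β k, p i = .I) →
    F (k + 1) p p = e k * F k p p
  succ_of_trivial' : ∀ (k : Fin M) p q, (∀ i ∈ ladder N M β k, p i = .I) →
    (∀ i ∈ ladder N M β k, q i = .I) → F k p q = 0 → F (k + 1) p q = 0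
  succ_of_eq : ∀ (k : Fin M) p q, (∀ i ∈ ladder N M β k, p i = q i) →
    (∃ i ∈ ladder N M β k, p i ≠ .I) →
    F (k + 1) p q = c k * ∑ t : {t : ladder N M β k → Pauli // t ≠ fun _ => .I},
      F k (overwrite (ladder N M β k) p t.1) (overwrite (ladder N M β k) q t.1)

section LadderValue

variable {N M β : ℕ} {κ : Fin M} {e c : Fin M → ℝ}
  {F : ℕ → (Fin N → Pauli) → (Fin N → Pauli) → ℝ}

theorem overwrite_of_mem {s : Finset (Fin N)} {p : Fin N → Pauli} {t : s → Pauli} {i : Fin N}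
    (hi : i ∈ s) : overwrite s p t i = t ⟨i, hi⟩ := dif_pos hi

theorem overwrite_of_notMem {s : Finset (Fin N)} {p : Fin N → Pauli} {t : s → Pauli} {i : Fin N}
    (hi : i ∉ s) : overwrite s p t i = p i := dif_neg hi

theorem LadderValue.nonneg (hF : LadderValue N M β e c F) (he : ∀ k, 0 ≤ e k)
    (hc : ∀ k, 0 ≤ c k) (k : ℕ) (hk : k ≤ M) (p : Fin N → Pauli) : 0 ≤ F k p p := by
  induction k generalizing p with
  | zero => exact hF.zero_nonneg p
  | succ k ih =>
    have ih := ih (by omega)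
    by_cases h : ∀ i ∈ ladder N M β ⟨k, hk⟩, p i = .I
    · rw [hF.succ_of_trivial ⟨k, hk⟩ p h]
      exact mul_nonneg (he _) (ih p)
    · push Not at h
      rw [hF.succ_of_eq ⟨k, hk⟩ p p (fun _ _ => rfl) h]
      exact mul_nonneg (hc _) (Finset.sum_nonneg fun t _ => ih _)

/-- A disagreement cannot heal. A block that contains such a qubit annihilates the pair; any other
block leaves the qubit alone, until a remaining block reaches it. -/
theorem LadderValue.eq_zero_of_ne (hF : LadderValue N M β e c F) (k : ℕ) (hk : k ≤ M)
    (p q : Fin N → Pauli) (h : ∃ i ∈ ladderBelow N M β k, p i ≠ q i) : F k p q = 0 := by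
  induction k generalizing p q with
  | zero =>
    obtain ⟨i, hi, -⟩ := h
    obtain ⟨j, hj, -⟩ := mem_ladderBelow.mp hi
    omega
  | succ k ih =>
    have ih := ih (by omega)
    by_cases hpq : ∃ i ∈ ladder N M β ⟨k, hk⟩, p i ≠ q i
    · exact hF.succ_of_ne ⟨k, hk⟩ p q hpq
    push Not at hpq
    obtain ⟨i, hi, hne⟩ := h
    obtain ⟨j, hj, hij⟩ := mem_ladderBelow.mp hi
    have hik : i ∉ ladder N M β ⟨k, hk⟩ := fun hm => hne (hpq i hm)
    have hi' : i ∈ ladderBelow N M β k := by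
      refine mem_ladderBelow.mpr ⟨j, ?_, hij⟩
      rcases Nat.lt_succ_iff_lt_or_eq.mp hj with h1 | h1
      · exact h1
      · exact absurd (show i ∈ ladder N M β ⟨k, hk⟩ from (Fin.ext h1 : j = ⟨k, hk⟩) ▸ hij) hik
    by_cases h : ∀ i ∈ ladder N M β ⟨k, hk⟩, p i = .I
    · exact hF.succ_of_trivial' ⟨k, hk⟩ p q h (fun i hi => hpq i hi ▸ h i hi)
        (ih p q ⟨i, hi', hne⟩)
    · push Not at h
      rw [hF.succ_of_eq ⟨k, hk⟩ p q hpq h, Finset.sum_eq_zero, mul_zero]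
      intro t _
      refine ih _ _ ⟨i, hi', ?_⟩
      rwa [overwrite_of_notMem hik, overwrite_of_notMem hik]

/-- One of the continuations of a mixed Pauli string bounds its value. -/
theorem LadderValue.mul_le_succ (hF : LadderValue N M β e c F) (he : ∀ k, 0 ≤ e k)
    (hc : ∀ k, 0 ≤ c k) (k : Fin M) (p : Fin N → Pauli) (h : ∃ i ∈ ladder N M β k, p i ≠ .I)
    {i₀ : Fin N} (hi₀ : i₀ ∈ ladder N M β k) :
    c k * F k (overwrite _ p (Function.update (fun _ : ladder N M β k => Pauli.I) ⟨i₀, hi₀⟩ .Z))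
      (overwrite _ p (Function.update (fun _ : ladder N M β k => Pauli.I) ⟨i₀, hi₀⟩ .Z))
      ≤ F (k + 1) p p := by
  rw [hF.succ_of_eq k p p (fun _ _ => rfl) h]
  refine mul_le_mul_of_nonneg_left ?_ (hc k)
  have ht : Function.update (fun _ : ladder N M β k => Pauli.I) ⟨i₀, hi₀⟩ .Z ≠ fun _ => .I := by
    intro h
    have := congrFun h ⟨i₀, hi₀⟩
    simp at this
  exact Finset.single_le_sum (f := fun t : {t : ladder N M β k → Pauli // t ≠ fun _ => .I} =>
    F k (overwrite (ladder N M β k) p t.1) (overwrite (ladder N M β k) p t.1))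
    (fun t _ => hF.nonneg he hc k k.2.le _) (Finset.mem_univ ⟨_, ht⟩)

theorem update_I_Z_eq {s : Finset (Fin N)} (j i : s) :
    Function.update (fun _ : s => Pauli.I) j .Z i = .I
      ∨ Function.update (fun _ : s => Pauli.I) j .Z i = .Z := by
  by_cases h : i = j
  · right; rw [h, Function.update_self]
  · left; rw [Function.update_of_ne h]

/-- Collapsing the part of a Pauli string on block `k` to a single `Z` on the last qubit, which the
earlier blocks do not touch. -/
theorem exists_collapse_last (hβ : 1 ≤ β) (hN : M + β ≤ N + 1) (k : Fin M) (p : Fin N → Pauli)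
    (hp : ∀ i, i ∉ ladderBelow N M β (k + 1) → p i = .I ∨ p i = .Z) :
    ∃ (i₀ : Fin N) (hi₀ : i₀ ∈ ladder N M β k),
      (∀ i, i ∉ ladderBelow N M β k →
        overwrite _ p (Function.update (fun _ : ladder N M β k => Pauli.I) ⟨i₀, hi₀⟩ .Z) i = .I ∨
        overwrite _ p (Function.update (fun _ : ladder N M β k => Pauli.I) ⟨i₀, hi₀⟩ .Z) i = .Z) ∧
      (ladderBelow N M β k).filter (fun i =>
        overwrite _ p (Function.update (fun _ : ladder N M β k => Pauli.I) ⟨i₀, hi₀⟩ .Z) i ≠ .I)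
        ⊆ Finset.univ.filter fun i : Fin N => (i : ℕ) < k ∧ p i ≠ .I := by
  have hk := k.2
  -- The last qubit of the block; `hN` is what keeps it among the `N` qubits.
  have hi₀ : (⟨k + β - 1, by omega⟩ : Fin N) ∈ ladder N M β k := by
    rw [mem_ladder]; dsimp only; omega
  refine ⟨_, hi₀, fun i hi => ?_, fun i hi => ?_⟩
  · by_cases hik : i ∈ ladder N M β k
    · rw [overwrite_of_mem hik]
      exact update_I_Z_eq _ _
    · rw [overwrite_of_notMem hik]
      refine hp i fun hm => ?_
      obtain ⟨j, hj, hij⟩ := mem_ladderBelow.mp hm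
      rcases Nat.lt_succ_iff_lt_or_eq.mp hj with h1 | h1
      · exact hi (mem_ladderBelow.mpr ⟨j, h1, hij⟩)
      · exact hik ((Fin.ext h1 : j = k) ▸ hij)
  · rw [Finset.mem_filter] at hi
    obtain ⟨hi, hne⟩ := hi
    obtain ⟨j, hj, hij⟩ := mem_ladderBelow.mp hi
    rw [mem_ladder] at hij
    have hik : i ∉ ladder N M β k := by
      intro hik
      rw [overwrite_of_mem hik, Function.update_of_ne] at hne
      · exact hne rfl
      · intro h
        have := congrArg (fun x : ladder N M β k => (x.1 : ℕ)) h
        dsimp only at this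
        omega
    rw [overwrite_of_notMem hik] at hne
    rw [mem_ladder] at hik
    simp only [Finset.mem_filter, Finset.mem_univ, true_and]
    exact ⟨by omega, hne⟩

/-- Qubit `i < k` is the first qubit of block `i`, hence still covered. The active qubit of block
`k` is at position at least `k`, so it is counted only on the right. -/
theorem card_lt_card_of_active (hβ : 1 ≤ β) (k : Fin M) (p : Fin N → Pauli)
    (h : ∃ i ∈ ladder N M β k, p i ≠ .I) :
    (Finset.univ.filter fun i : Fin N => (i : ℕ) < k ∧ p i ≠ .I).card
      < ((ladderBelow N M β (k + 1)).filter fun i => p i ≠ .I).card := by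
  obtain ⟨i₀, hi₀, hp⟩ := h
  refine Finset.card_lt_card (Finset.ssubset_iff_of_subset ?_ |>.mpr ⟨i₀, ?_, ?_⟩)
  · intro i hi
    simp only [Finset.mem_filter, Finset.mem_univ, true_and, mem_ladderBelow] at hi ⊢
    have hk := k.2
    refine ⟨⟨⟨i, by omega⟩, ?_, mem_ladder.mpr ?_⟩, hi.2⟩ <;> dsimp only <;> omega
  · exact Finset.mem_filter.mpr ⟨mem_ladderBelow.mpr ⟨k, by omega, hi₀⟩, hp⟩
  · rw [mem_ladder] at hi₀
    simp only [Finset.mem_filter, Finset.mem_univ, true_and]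
    omega

theorem ladderBelow_mono {k l : ℕ} (h : k ≤ l) : ladderBelow N M β k ⊆ ladderBelow N M β l := by
  intro i hi
  obtain ⟨j, hj, hij⟩ := mem_ladderBelow.mp hi
  exact mem_ladderBelow.mpr ⟨j, by omega, hij⟩

theorem eq_I_or_Z_of_trivial {k : Fin M} {p : Fin N → Pauli}
    (hp : ∀ i, i ∉ ladderBelow N M β (k + 1) → p i = .I ∨ p i = .Z)
    (h : ∀ i ∈ ladder N M β k, p i = .I) (i : Fin N) (hi : i ∉ ladderBelow N M β k) :
    p i = .I ∨ p i = .Z := by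
  by_cases hik : i ∈ ladder N M β k
  · exact Or.inl (h i hik)
  · refine hp i fun hm => ?_
    obtain ⟨j, hj, hij⟩ := mem_ladderBelow.mp hm
    rcases Nat.lt_succ_iff_lt_or_eq.mp hj with h1 | h1
    · exact hi (mem_ladderBelow.mpr ⟨j, h1, hij⟩)
    · exact hik ((Fin.ext h1 : j = k) ▸ hij)

/-- Before the differential block, each active block costs a factor `w`, and removes at least one
qubit from the support. -/
theorem LadderValue.pow_le_of_le (hF : LadderValue N M β e c F) (he : ∀ k, 0 ≤ e k)
    (hβ : 1 ≤ β) (hN : M + β ≤ N + 1) (he1 : ∀ k, k ≠ κ → e k = 1)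
    {w : ℝ} (hw0 : 0 ≤ w) (hw1 : w ≤ 1) (hc : ∀ k, w ≤ c k)
    (k : ℕ) (hk : k ≤ κ) (m : ℕ) (p : Fin N → Pauli)
    (hp : ∀ i, i ∉ ladderBelow N M β k → p i = .I ∨ p i = .Z)
    (hm : ((ladderBelow N M β k).filter fun i => p i ≠ .I).card ≤ m) : w ^ m ≤ F k p p := by
  have hc0 : ∀ k, 0 ≤ c k := fun k => hw0.trans (hc k)
  induction k generalizing m p with
  | zero =>
    -- With no blocks left, `hp` speaks of every qubit: the string consists of I's and Z's.
    rw [hF.zero_eq_one p fun i => hp i fun hi => by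
      obtain ⟨j, hj, -⟩ := mem_ladderBelow.mp hi
      omega]
    exact pow_le_one₀ hw0 hw1
  | succ k ih =>
    have ih := ih (by omega)
    have hkM : k < M := by have := κ.2; omega
    by_cases h : ∀ i ∈ ladder N M β ⟨k, hkM⟩, p i = .I
    · rw [hF.succ_of_trivial ⟨k, hkM⟩ p h, he1 _ (by intro h; rw [← h] at hk; simp at hk), one_mul]
      refine ih m p (eq_I_or_Z_of_trivial hp h) (le_trans (Finset.card_le_card ?_) hm)
      exact Finset.filter_subset_filter _ (ladderBelow_mono k.le_succ)
    · push Not at h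
      obtain ⟨i₀, hi₀, h1, h2⟩ := exists_collapse_last hβ hN ⟨k, hkM⟩ p hp
      have h3 := card_lt_card_of_active hβ ⟨k, hkM⟩ p h
      have h4 := Finset.card_le_card h2
      -- The strict decrease forces the count, and with it `m`, to be positive.
      obtain ⟨m, rfl⟩ : ∃ m', m = m' + 1 := ⟨m - 1, by dsimp only at h3 h4; omega⟩
      refine le_trans ?_ (hF.mul_le_succ he hc0 ⟨k, hkM⟩ p h hi₀)
      rw [pow_succ']
      exact mul_le_mul (hc _) (ih m _ h1 (by dsimp only at h3 h4; omega)) (pow_nonneg hw0 _) (hc0 _)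

/-- From an active block behind the differential one, the walk is led to the differential block by
collapsing to the first qubit of each block. -/
theorem LadderValue.two_mul_pow_le_of_active (hF : LadderValue N M β e c F)
    (he : ∀ k, 0 ≤ e k) (hβ : 2 ≤ β) (hN : M + β ≤ N + 1) (he1 : ∀ k, k ≠ κ → e k = 1)
    {w : ℝ} (hw0 : 0 ≤ w) (hw1 : w ≤ 1) (hc : ∀ k, w ≤ c k) (hcκ : 2 * w ≤ c κ)
    (d : ℕ) (hd : κ + d < M) (m : ℕ) (p : Fin N → Pauli)
    (hact : ∃ i ∈ ladder N M β ⟨κ + d, hd⟩, p i ≠ .I)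
    (hp : ∀ i, i ∉ ladderBelow N M β (κ + d + 1) → p i = .I ∨ p i = .Z)
    (hm : (Finset.univ.filter fun i : Fin N => (i : ℕ) < κ ∧ p i ≠ .I).card ≤ m) :
    2 * w ^ (d + 1 + m) ≤ F (κ + d + 1) p p := by
  have hc0 : ∀ k, 0 ≤ c k := fun k => hw0.trans (hc k)
  induction d generalizing p with
  | zero =>
    -- At the differential block the strategy changes to the last qubit, and its weight supplies the
    -- factor 2.
    obtain ⟨i₀, hi₀, h1, h2⟩ := exists_collapse_last (by omega) hN κ p hp
    refine le_trans ?_ (hF.mul_le_succ he hc0 κ p hact hi₀)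
    rw [zero_add, pow_add, pow_one, ← mul_assoc]
    exact mul_le_mul hcκ (hF.pow_le_of_le he (by omega) hN he1 hw0 hw1 hc κ le_rfl m _ h1
      ((Finset.card_le_card h2).trans hm)) (pow_nonneg hw0 _) (hc0 _)
  | succ d ih =>
    -- The first qubit of this block. As β ≥ 2 it also lies in block `κ + d`, which is therefore
    -- active in turn.
    have hi₀ : (⟨κ + (d + 1), by omega⟩ : Fin N) ∈ ladder N M β ⟨κ + (d + 1), hd⟩ := by
      rw [mem_ladder]; dsimp only; omega
    have hlt : κ + d < M := by omega
    refine le_trans ?_ (hF.mul_le_succ he hc0 ⟨κ + (d + 1), hd⟩ p hact hi₀)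
    rw [show d + 1 + 1 + m = d + 1 + m + 1 by ring, pow_succ', ← mul_assoc, mul_comm 2 w, mul_assoc]
    refine mul_le_mul (hc _) ?_ (by positivity) (hc0 _)
    refine ih hlt _ ⟨⟨κ + (d + 1), by omega⟩, ?_, ?_⟩ ?_ (le_trans (Finset.card_le_card ?_) hm)
    · rw [mem_ladder]; dsimp only; omega
    · rw [overwrite_of_mem hi₀, Function.update_self]
      exact Pauli.noConfusion
    · intro i hi
      by_cases hik : i ∈ ladder N M β ⟨κ + (d + 1), hd⟩
      · rw [overwrite_of_mem hik]
        exact update_I_Z_eq _ _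
      · rw [overwrite_of_notMem hik]
        refine hp i fun hm => ?_
        obtain ⟨j, hj, hij⟩ := mem_ladderBelow.mp hm
        rcases Nat.lt_succ_iff_lt_or_eq.mp hj with h1 | h1
        · exact hi (mem_ladderBelow.mpr ⟨j, h1, hij⟩)
        · exact hik ((Fin.ext h1 : j = ⟨κ + (d + 1), hd⟩) ▸ hij)
    · intro i hi
      simp only [Finset.mem_filter, Finset.mem_univ, true_and] at hi ⊢
      refine ⟨hi.1, ?_⟩
      have hik : i ∉ ladder N M β ⟨κ + (d + 1), hd⟩ := by
        rw [mem_ladder]; dsimp only; omega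
      have h2 := hi.2
      rwa [overwrite_of_notMem hik] at h2

/-- Blocks beyond the last one that meets the string have weight 1, provided the differential block
is not among them. -/
theorem LadderValue.eq_of_inactive (hF : LadderValue N M β e c F)
    (he1 : ∀ k, k ≠ κ → e k = 1) (p : Fin N → Pauli) (l : ℕ) (hl : κ < l)
    (h : ∀ k : Fin M, l ≤ k → ∀ i ∈ ladder N M β k, p i = .I) (k : ℕ) (hlk : l ≤ k) (hk : k ≤ M) :
    F k p p = F l p p := by
  induction k, hlk using Nat.le_induction with
  | base => rfl
  | succ k hlk ih =>
    rw [hF.succ_of_trivial ⟨k, hk⟩ p (h ⟨k, hk⟩ hlk), he1, one_mul, ih (by omega)]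
    intro h
    rw [← h] at hl
    dsimp only at hl
    omega

/-- Some support qubit lies in block `k'`, hence at position at least κ, so at most `r - 1` lie
below κ. With `d = k' - κ`, the exponent is d + 1 for the blocks from `k'` to κ, plus r - 1. -/
theorem LadderValue.two_mul_pow_le (hF : LadderValue N M β e c F)
    (he : ∀ k, 0 ≤ e k) (hβ : 2 ≤ β) (hN : M + β ≤ N + 1) (he1 : ∀ k, k ≠ κ → e k = 1)
    {w : ℝ} (hw0 : 0 ≤ w) (hw1 : w ≤ 1) (hc : ∀ k, w ≤ c k) (hcκ : 2 * w ≤ c κ)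
    {r : ℕ} (p : Fin N → Pauli) (hr : (pauliSupport p).card ≤ r)
    (hs : pauliSupport p ⊆ Finset.univ.biUnion (ladder N M β)) (k' : Fin M)
    (hk' : IsGreatest {k | (ladder N M β k ∩ pauliSupport p).Nonempty} k') (hκ : κ ≤ k') :
    2 * w ^ ((k' : ℕ) - κ + r) ≤ F M p p := by
  have hsupp : ∀ i, i ∈ pauliSupport p ↔ p i ≠ .I := fun i => by simp [pauliSupport]
  have hκ' : (κ : ℕ) ≤ k' := hκ
  have hle : ∀ (k : Fin M) (i : Fin N), i ∈ ladder N M β k → p i ≠ .I → k ≤ k' := fun k i hi hp =>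
    hk'.2 ⟨i, Finset.mem_inter.mpr ⟨hi, (hsupp i).mpr hp⟩⟩
  rw [hF.eq_of_inactive he1 p (k' + 1) (by omega) (fun k hk i hi => by
    by_contra hp
    have : (k : ℕ) ≤ k' := hle k i hi hp
    omega) M (by omega) le_rfl]
  obtain ⟨i₀, hi₀⟩ := hk'.1
  rw [Finset.mem_inter, hsupp] at hi₀
  obtain ⟨d, hd⟩ : ∃ d, (k' : ℕ) = κ + d := ⟨k' - κ, by omega⟩
  have hdM : κ + d < M := hd ▸ k'.2
  have hkd : k' = ⟨κ + d, hdM⟩ := Fin.ext hd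
  have hlt : (Finset.univ.filter fun i : Fin N => (i : ℕ) < κ ∧ p i ≠ .I).card
      < (pauliSupport p).card := by
    refine Finset.card_lt_card (Finset.ssubset_iff_of_subset ?_ |>.mpr ⟨i₀, ?_, ?_⟩)
    · intro i hi
      rw [hsupp]
      exact (Finset.mem_filter.mp hi).2.2
    · exact (hsupp i₀).mpr hi₀.2
    · have := mem_ladder.mp hi₀.1
      simp only [Finset.mem_filter, Finset.mem_univ, true_and]
      omega
  have := hF.two_mul_pow_le_of_active he hβ hN he1 hw0 hw1 hc hcκ d hdM (r - 1) p
    ⟨i₀, hkd ▸ hi₀.1, hi₀.2⟩ (fun i hi => by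
      left
      by_contra hp
      obtain ⟨k, -, hk⟩ := Finset.mem_biUnion.mp (hs ((hsupp i).mpr hp))
      have : (k : ℕ) ≤ k' := hle k i hk hp
      exact hi (mem_ladderBelow.mpr ⟨k, by omega, hk⟩)) (by omega)
  rw [hd, show (κ : ℕ) + d - κ + r = d + 1 + (r - 1) by omega]
  exact this

end LadderValue

/-! ### Partial products -/

section PartialProducts

variable {α : Type*} [Monoid α] {n : ℕ}

/-- The product of the first `k` factors, later factors standing to the left. -/
def lowProd (f : Fin n → α) (k : ℕ) : α := ((List.ofFn f).take k).reverse.prod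

/-- The product of all but the first `k` factors, later factors standing to the left. -/
def highProd (f : Fin n → α) (k : ℕ) : α := ((List.ofFn f).drop k).reverse.prod

theorem lowProd_zero (f : Fin n → α) : lowProd f 0 = 1 := by simp [lowProd]

theorem lowProd_succ (f : Fin n → α) {k : ℕ} (hk : k < n) :
    lowProd f (k + 1) = f ⟨k, hk⟩ * lowProd f k := by
  have hk' : k < (List.ofFn f).length := by simpa using hk
  rw [lowProd, ← List.take_concat_get' _ _ hk', List.reverse_append]
  simp [lowProd]

theorem highProd_self (f : Fin n → α) : highProd f n = 1 := by
  rw [highProd, List.drop_eq_nil_of_le (by simp), List.reverse_nil, List.prod_nil]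

theorem highProd_eq (f : Fin n → α) {k : ℕ} (hk : k < n) :
    highProd f k = highProd f (k + 1) * f ⟨k, hk⟩ := by
  have hk' : k < (List.ofFn f).length := by simpa using hk
  rw [highProd, List.drop_eq_getElem_cons hk']
  simp [highProd]

theorem prod_reverse_ofFn (f : Fin n → α) (k : Fin n) :
    (List.ofFn f).reverse.prod = highProd f (k + 1) * f k * lowProd f k := by
  rw [← highProd_eq f k.2, highProd, lowProd, ← List.prod_append, ← List.reverse_append,
    List.take_append_drop]

/-- A property of all partial products with factors of index less than `k`. -/
theorem lowProd_induction {p : α → Prop} (h1 : p 1) (hmul : ∀ a b, p a → p b → p (a * b))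
    {f : Fin n → α} {k : ℕ} (hk : k ≤ n) (h : ∀ i : Fin n, (i : ℕ) < k → p (f i)) :
    p (lowProd f k) := by
  induction k with
  | zero => rwa [lowProd_zero]
  | succ k ih =>
    rw [lowProd_succ f hk]
    exact hmul _ _ (h _ k.lt_succ_self) (ih (by omega) fun i hi => h i (by omega))

theorem highProd_induction {p : α → Prop} (h1 : p 1) (hmul : ∀ a b, p a → p b → p (a * b))
    {f : Fin n → α} {k : ℕ} (hk : k ≤ n) (h : ∀ i : Fin n, k ≤ (i : ℕ) → p (f i)) :
    p (highProd f k) := by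
  induction hk using Nat.decreasingInduction with
  | self => rwa [highProd_self]
  | of_succ k hk ih =>
    rw [highProd_eq f hk]
    exact hmul _ _ (ih fun i hi => h i (by omega)) (h _ le_rfl)

theorem lowProd_congr {f g : Fin n → α} {k : ℕ} (hk : k ≤ n)
    (h : ∀ i : Fin n, (i : ℕ) < k → f i = g i) : lowProd f k = lowProd g k := by
  induction k with
  | zero => rw [lowProd_zero, lowProd_zero]
  | succ k ih =>
    rw [lowProd_succ f hk, lowProd_succ g hk, h _ k.lt_succ_self,
      ih (by omega) fun i hi => h i (by omega)]

theorem highProd_congr {f g : Fin n → α} {k : ℕ} (hk : k ≤ n)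
    (h : ∀ i : Fin n, k ≤ (i : ℕ) → f i = g i) : highProd f k = highProd g k := by
  induction hk using Nat.decreasingInduction with
  | self => rw [highProd_self, highProd_self]
  | of_succ k hk ih =>
    rw [highProd_eq f hk, highProd_eq g hk, h ⟨k, hk⟩ le_rfl, ih fun i hi => h i (by omega)]

end PartialProducts

/-! ### Measurability and independence -/

section Measurability

variable {m : Type*} [Fintype m]

instance matrixSecondCountableTopology : SecondCountableTopology (Matrix m m ℂ) :=
  inferInstanceAs (SecondCountableTopology (m → m → ℂ))

theorem measurable_matrix_mul {Ω : Type*} {_ : MeasurableSpace Ω} {V W : Ω → Matrix m m ℂ}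
    (hV : Measurable V) (hW : Measurable W) : Measurable fun ω => V ω * W ω :=
  hV.mul hW

variable [DecidableEq m]

/-- The σ-algebra on `Ω` is left free so that the lemma also applies to the σ-algebra generated by a
subset of the pieces. -/
theorem measurable_lowProd {Ω : Type*} {_ : MeasurableSpace Ω} {n k : ℕ}
    {f : Ω → Fin n → Matrix m m ℂ} (hk : k ≤ n)
    (h : ∀ i : Fin n, (i : ℕ) < k → Measurable fun ω => f ω i) :
    Measurable fun ω => lowProd (f ω) k := by
  induction k with
  | zero => simp only [lowProd_zero]; exact measurable_const
  | succ k ih =>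
    simp only [lowProd_succ _ hk]
    exact measurable_matrix_mul (h _ k.lt_succ_self) (ih (by omega) fun i hi => h i (by omega))

theorem measurable_highProd {Ω : Type*} {_ : MeasurableSpace Ω} {n k : ℕ}
    {f : Ω → Fin n → Matrix m m ℂ} (hk : k ≤ n)
    (h : ∀ i : Fin n, k ≤ (i : ℕ) → Measurable fun ω => f ω i) :
    Measurable fun ω => highProd (f ω) k := by
  induction hk using Nat.decreasingInduction with
  | self => simp only [highProd_self]; exact measurable_const
  | of_succ k hk ih =>
    simp only [highProd_eq _ hk]
    exact measurable_matrix_mul (ih fun i hi => h i (by omega)) (h _ le_rfl)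

end Measurability

/-- Disjoint subfamilies generate independent σ-algebras. Stating the hypotheses as measurability
lets independence of partial products follow from closure under multiplication. -/
theorem indepFun_of_iIndepFun_of_disjoint {Ω ι α β γ : Type*} {_ : MeasurableSpace Ω}
    [mα : MeasurableSpace α] [mβ : MeasurableSpace β] [mγ : MeasurableSpace γ] {P : Measure Ω}
    {f : ι → Ω → α} (hf : iIndepFun f P) (hm : ∀ i, Measurable (f i)) {S T : Set ι}
    (hST : Disjoint S T) {V : Ω → β} {W : Ω → γ}
    (hV : Measurable[⨆ i ∈ S, MeasurableSpace.comap (f i) mα] V)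
    (hW : Measurable[⨆ i ∈ T, MeasurableSpace.comap (f i) mα] W) : IndepFun V W P := by
  rw [IndepFun_iff_Indep]
  have h := indep_iSup_of_disjoint (fun i => (hm i).comap_le) hf.iIndep hST
  exact indep_of_indep_of_le_left (indep_of_indep_of_le_right h hW.comap_le) hV.comap_le

theorem measurable_iSup_comap {Ω ι α : Type*} [mα : MeasurableSpace α] (f : ι → Ω → α)
    {S : Set ι} {i : ι} (hi : i ∈ S) :
    Measurable[⨆ i ∈ S, MeasurableSpace.comap (f i) mα] (f i) :=
  (comap_measurable (f i)).mono (le_iSup₂ (f := fun i (_ : i ∈ S) =>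
    MeasurableSpace.comap (f i) mα) i hi) le_rfl

/-! ### The derivative of the cost -/

section Exponential

variable {m : Type*} [Fintype m] [DecidableEq m]

attribute [local instance] Matrix.linftyOpNormedRing Matrix.linftyOpNormedAlgebra

theorem continuous_matrix_exp : Continuous (NormedSpace.exp : Matrix m m ℂ → Matrix m m ℂ) :=
  NormedSpace.exp_continuous

theorem exp_neg_I_conjTranspose {A : Matrix m m ℂ} (hA : A.IsHermitian) (t : ℝ) :
    (NormedSpace.exp ((-Complex.I * (t : ℂ)) • A))ᴴ
      = NormedSpace.exp ((Complex.I * (t : ℂ)) • A) := by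
  rw [← Matrix.exp_conjTranspose, Matrix.conjTranspose_smul, hA.eq]
  simp

theorem exp_neg_I_mem_unitaryGroup {A : Matrix m m ℂ} (hA : A.IsHermitian) (t : ℝ) :
    NormedSpace.exp ((-Complex.I * (t : ℂ)) • A) ∈ Matrix.unitaryGroup m ℂ := by
  rw [Matrix.mem_unitaryGroup_iff', Matrix.star_eq_conjTranspose, exp_neg_I_conjTranspose hA,
    ← Matrix.exp_add_of_commute]
  · rw [← add_smul]
    simp
  · exact (Commute.refl A).smul_left _ |>.smul_right _

/-- The Heisenberg equation for one gate in a larger product. -/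
theorem hasDerivAt_conj_exp {N : ℕ} (s : Finset (Fin N)) {A : QubitMatrix s}
    (hA : A.IsHermitian) (R L H : QubitMatrix (Fin N)) (x : Fin N → Fin 2) (t : ℝ) :
    HasDerivAt (fun t : ℝ =>
      (((R * extendById s (NormedSpace.exp ((-Complex.I * (t : ℂ)) • A)) * L)ᴴ * H *
        (R * extendById s (NormedSpace.exp ((-Complex.I * (t : ℂ)) • A)) * L)) x x).re)
      ((Lᴴ * commutatorMap (extendById s A)
        ((R * extendById s (NormedSpace.exp ((-Complex.I * (t : ℂ)) • A)))ᴴ * H *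
          (R * extendById s (NormedSpace.exp ((-Complex.I * (t : ℂ)) • A)))) * L) x x).re t := by
  -- In finite dimension both linear maps are continuous, so derivatives pass through the extension
  -- and through the entry.
  let ext : QubitMatrix s →ₗ[ℝ] QubitMatrix (Fin N) :=
    { toFun := extendById s
      map_add' := fun A B => by
        ext x y
        simp only [extendById, Matrix.add_apply]
        split_ifs <;> simp
      map_smul' := fun c A => by
        ext x y
        simp only [extendById, Matrix.smul_apply, RingHom.id_apply]
        split_ifs <;> simp }
  let entry : QubitMatrix (Fin N) →ₗ[ℝ] ℝ :=
    { toFun := fun B => (B x x).re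
      map_add' := fun A B => by simp
      map_smul' := fun c A => by simp }
  have hexp : ∀ c : ℂ, ∀ t : ℝ, HasDerivAt
      (fun t : ℝ => extendById s (NormedSpace.exp ((c * (t : ℂ)) • A)))
      (c • (extendById s A * extendById s (NormedSpace.exp ((c * (t : ℂ)) • A)))) t := by
    intro c t
    have h1 : HasDerivAt (fun t : ℝ => NormedSpace.exp (t • (c • A)))
        ((c • A) * NormedSpace.exp (t • (c • A))) t := hasDerivAt_exp_smul_const' (c • A) t
    have h2 : ∀ t : ℝ, t • (c • A) = (c * (t : ℂ)) • A := by
      intro t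
      rw [mul_comm, mul_smul, Complex.coe_smul]
    simp only [h2] at h1
    have h3 : HasDerivAt
        (fun t : ℝ => extendById s (NormedSpace.exp ((c * (t : ℂ)) • A)))
        (extendById s (c • A * NormedSpace.exp ((c * (t : ℂ)) • A))) t :=
      (LinearMap.toContinuousLinearMap ext).hasFDerivAt.comp_hasDerivAt t h1
    have h4 : extendById s (c • A * NormedSpace.exp ((c * (t : ℂ)) • A))
        = c • (extendById s A * extendById s (NormedSpace.exp ((c * (t : ℂ)) • A))) := by
      rw [← extendById_mul]
      ext x y
      simp only [extendById, Matrix.smul_apply, smul_mul_assoc]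
      split_ifs <;> simp
    rwa [h4] at h3
  -- The generator commutes with its own gate; this moves it outside the conjugated observable and
  -- produces the commutator.
  have hcomm : extendById s A * extendById s (NormedSpace.exp ((-Complex.I * (t : ℂ)) • A))
      = extendById s (NormedSpace.exp ((-Complex.I * (t : ℂ)) • A)) * extendById s A := by
    rw [← extendById_mul, ← extendById_mul]
    have : Commute A (NormedSpace.exp ((-Complex.I * (t : ℂ)) • A)) :=
      ((Commute.refl A).smul_right _).exp_right
    rw [this.eq]
  -- Product rule, with the adjoint gate written as exp(+itA) so that both factors are instances of
  -- `hexp`.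
  have hd := (((hexp Complex.I t).const_mul (Lᴴ)).mul_const (Rᴴ * H * R)).mul
    ((hexp (-Complex.I) t).mul_const L)
  have he : HasDerivAt (fun t : ℝ =>
      ((Lᴴ * extendById s (NormedSpace.exp ((Complex.I * (t : ℂ)) • A)) * (Rᴴ * H * R) *
        (extendById s (NormedSpace.exp ((-Complex.I * (t : ℂ)) • A)) * L)) x x).re) _ t :=
    (LinearMap.toContinuousLinearMap entry).hasFDerivAt.comp_hasDerivAt t hd
  have hfun : ∀ t : ℝ,
      (R * extendById s (NormedSpace.exp ((-Complex.I * (t : ℂ)) • A)) * L)ᴴ * H *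
        (R * extendById s (NormedSpace.exp ((-Complex.I * (t : ℂ)) • A)) * L)
      = Lᴴ * extendById s (NormedSpace.exp ((Complex.I * (t : ℂ)) • A)) * (Rᴴ * H * R) *
        (extendById s (NormedSpace.exp ((-Complex.I * (t : ℂ)) • A)) * L) := by
    intro t
    simp only [Matrix.conjTranspose_mul, extendById_conjTranspose, exp_neg_I_conjTranspose hA,
      Matrix.mul_assoc]
  simp only [hfun]
  refine he.congr_deriv ?_
  refine congrArg (fun B : QubitMatrix (Fin N) => (B x x).re) ?_
  simp only [Matrix.conjTranspose_mul, extendById_conjTranspose, exp_neg_I_conjTranspose hA,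
    commutatorMap_apply, hcomm]
  simp only [Matrix.mul_assoc, Matrix.smul_mul, Matrix.mul_smul, mul_sub, sub_mul, neg_smul,
    smul_sub, Matrix.mul_neg, Matrix.neg_mul]
  rw [sub_eq_add_neg]

end Exponential

/-! ### Expectations along a sequence of channels -/

section ChannelValue

variable {N : ℕ}

/-- The entry `⟨00| · |00⟩` after the maps `Φ (k - 1), …, Φ 0` have been applied in this order. -/
def channelValue (Φ : ℕ →
    (Matrix ((Fin N → Fin 2) × (Fin N → Fin 2)) ((Fin N → Fin 2) × (Fin N → Fin 2)) ℂ →ₗ[ℂ]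
      Matrix ((Fin N → Fin 2) × (Fin N → Fin 2)) ((Fin N → Fin 2) × (Fin N → Fin 2)) ℂ)) :
    ℕ → Matrix ((Fin N → Fin 2) × (Fin N → Fin 2)) ((Fin N → Fin 2) × (Fin N → Fin 2)) ℂ →ₗ[ℂ] ℂ
  | 0 => Matrix.entryLinearMap ℂ ℂ ((fun _ => 0), fun _ => 0) ((fun _ => 0), fun _ => 0)
  | k + 1 => channelValue Φ k ∘ₗ Φ k

theorem Pauli.toMatrix_zero_zero (a : Pauli) :
    a.toMatrix 0 0 = if a = .I ∨ a = .Z then 1 else 0 := by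
  cases a <;> simp [Pauli.toMatrix]

theorem pauliString_zero_zero {Q : Type*} [Fintype Q] (p : Q → Pauli) :
    pauliString p (fun _ => 0) (fun _ => 0)
      = (((∏ q, if p q = .I ∨ p q = .Z then 1 else 0 : ℝ) : ℝ) : ℂ) := by
  rw [pauliString_apply, Complex.ofReal_prod]
  refine Finset.prod_congr rfl fun q _ => ?_
  rw [Pauli.toMatrix_zero_zero]
  split_ifs <;> simp

theorem channelValue_zero_pauliString (Φ) (p : Fin N → Pauli) :
    (channelValue Φ 0 (pauliString p ⊗ₖ pauliString p)).re
      = (∏ q, if p q = .I ∨ p q = .Z then 1 else 0 : ℝ) ^ 2 := by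
  have : channelValue Φ 0 (pauliString p ⊗ₖ pauliString p)
      = pauliString p (fun _ => 0) (fun _ => 0) * pauliString p (fun _ => 0) (fun _ => 0) := rfl
  rw [this, pauliString_zero_zero, ← Complex.ofReal_mul, Complex.ofReal_re, sq]

/-- The weights are real, so the real parts satisfy the same recursion. At the bottom a string
contributes the square of its expectation in |0…0⟩, which is 0 or 1. -/
theorem ladderValue_channelValue {M β : ℕ} {e c : Fin M → ℝ} {Φ}
    (h : ∀ k : Fin M, IsPauliMixing (ladder N M β k) (e k) (c k) (Φ k)) :
    LadderValue N M β e c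
      fun k p q => (channelValue Φ k (pauliString p ⊗ₖ pauliString q)).re where
  zero_nonneg p := by
    rw [channelValue_zero_pauliString]
    positivity
  zero_eq_one p hp := by
    rw [channelValue_zero_pauliString, Finset.prod_eq_one fun q _ => if_pos (hp q), one_pow]
  succ_of_ne k p q hpq := by
    rw [channelValue, LinearMap.comp_apply, (h k).of_ne p q hpq, map_zero, Complex.zero_re]
  succ_of_trivial k p hp := by
    rw [channelValue, LinearMap.comp_apply, (h k).of_trivial p p hp hp, map_smul, smul_eq_mul,
      Complex.re_ofReal_mul]
  succ_of_trivial' k p q hp hq hF := by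
    rw [channelValue, LinearMap.comp_apply, (h k).of_trivial p q hp hq, map_smul, smul_eq_mul,
      Complex.re_ofReal_mul, hF, mul_zero]
  succ_of_eq k p q hpq hp := by
    rw [channelValue, LinearMap.comp_apply, (h k).of_eq p q hpq hp, map_smul, smul_eq_mul,
      Complex.re_ofReal_mul, map_sum, Complex.re_sum]

end ChannelValue

/-! ### The circuit cut at the differential gate -/

namespace BlockCircuit

variable {N M : ℕ} {supp : Fin M → Finset (Fin N)} (C : BlockCircuit supp)

/-- The block `k` as an operator on all qubits. -/
def extBlock (θ : C.Params) (k : Fin M) : QubitMatrix (Fin N) := extendById (supp k) (C.block θ k)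

variable (κ : Fin M) (a : Fin (C.numGates κ))

/-- The part of the circuit before the gate `a` of block `κ`. -/
def lowPart (θ : C.Params) : QubitMatrix (Fin N) :=
  extendById (supp κ) (C.before θ κ a) * lowProd (C.extBlock θ) κ

/-- The part of the circuit that begins with the gate `a` of block `κ`. -/
def highPart (θ : C.Params) : QubitMatrix (Fin N) :=
  highProd (C.extBlock θ) (κ + 1) * extendById (supp κ) (C.after θ κ a) *
    extendById (supp κ) (C.gate θ κ a)

theorem block_eq (θ : C.Params) :
    C.block θ κ = C.after θ κ a * C.gate θ κ a * C.before θ κ a :=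
  prod_reverse_ofFn (C.gate θ κ) a

theorem unitary_eq (θ : C.Params) :
    C.unitary θ = highProd (C.extBlock θ) (κ + 1) * extendById (supp κ) (C.after θ κ a) *
      extendById (supp κ) (C.gate θ κ a) * C.lowPart κ a θ := by
  have h : C.unitary θ = highProd (C.extBlock θ) (κ + 1) * C.extBlock θ κ *
      lowProd (C.extBlock θ) κ := prod_reverse_ofFn (C.extBlock θ) κ
  rw [h, lowPart, extBlock, block_eq C κ a, extendById_mul, extendById_mul]
  simp only [mul_assoc]

/-! ### Dependence of the circuit on the differentiated parameter -/

section Update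

variable (θ : C.Params) (t : ℝ)

theorem gate_update_self : C.gate (Function.update θ ⟨κ, a⟩ t) κ a
    = NormedSpace.exp ((-Complex.I * (t : ℂ)) • C.gen κ a) := by
  rw [gate, Function.update_self]

theorem gate_update_of_ne (k : Fin M) (b : Fin (C.numGates k))
    (h : (⟨k, b⟩ : Σ k : Fin M, Fin (C.numGates k)) ≠ ⟨κ, a⟩) :
    C.gate (Function.update θ ⟨κ, a⟩ t) k b = C.gate θ k b := by
  rw [gate, Function.update_of_ne h, gate]

theorem block_update_of_ne (k : Fin M) (hk : k ≠ κ) :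
    C.block (Function.update θ ⟨κ, a⟩ t) k = C.block θ k := by
  have h : C.gate (Function.update θ ⟨κ, a⟩ t) k = C.gate θ k := funext fun b =>
    C.gate_update_of_ne κ a θ t k b fun h => hk (congrArg Sigma.fst h)
  rw [block, h, block]

theorem before_update : C.before (Function.update θ ⟨κ, a⟩ t) κ a = C.before θ κ a :=
  lowProd_congr a.2.le fun b hb => C.gate_update_of_ne κ a θ t κ b fun h => by
    rw [Sigma.mk.injEq, heq_eq_eq] at h
    rw [h.2] at hb
    exact lt_irrefl _ hb

theorem after_update : C.after (Function.update θ ⟨κ, a⟩ t) κ a = C.after θ κ a :=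
  highProd_congr a.2 fun b hb => C.gate_update_of_ne κ a θ t κ b fun h => by
    rw [Sigma.mk.injEq, heq_eq_eq] at h
    rw [h.2] at hb
    omega

theorem unitary_update : C.unitary (Function.update θ ⟨κ, a⟩ t)
    = highProd (C.extBlock θ) (κ + 1) * extendById (supp κ) (C.after θ κ a) *
      extendById (supp κ) (NormedSpace.exp ((-Complex.I * (t : ℂ)) • C.gen κ a)) *
      C.lowPart κ a θ := by
  have h1 : highProd (C.extBlock (Function.update θ ⟨κ, a⟩ t)) (κ + 1)
      = highProd (C.extBlock θ) (κ + 1) := highProd_congr κ.2 fun k hk => by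
    rw [extBlock, C.block_update_of_ne κ a θ t k (by rintro rfl; omega), extBlock]
  have h2 : lowProd (C.extBlock (Function.update θ ⟨κ, a⟩ t)) κ
      = lowProd (C.extBlock θ) κ := lowProd_congr κ.2.le fun k hk => by
    rw [extBlock, C.block_update_of_ne κ a θ t k (by rintro rfl; omega), extBlock]
  rw [C.unitary_eq κ a, h1, C.after_update, C.gate_update_self, lowPart, h2, C.before_update,
    lowPart]

end Update

theorem costDeriv_eq (H : QubitMatrix (Fin N)) (θ : C.Params) :
    C.costDeriv H κ a θ = (((C.lowPart κ a θ)ᴴ *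
      commutatorMap (extendById (supp κ) (C.gen κ a))
        ((C.highPart κ a θ)ᴴ * H * C.highPart κ a θ) * C.lowPart κ a θ)
      (fun _ => 0) (fun _ => 0)).re := by
  simp only [costDeriv, cost, C.unitary_update]
  exact (hasDerivAt_conj_exp (supp κ) (C.gen_isHermitian κ a) _ _ H _ _).deriv

/-! ### Measurability -/

theorem measurable_gate (k : Fin M) (b : Fin (C.numGates k)) :
    Measurable fun θ => C.gate θ k b := by
  have h : Continuous fun t : ℝ =>
      NormedSpace.exp ((-Complex.I * (t : ℂ)) • C.gen k b) :=
    continuous_matrix_exp.comp (by fun_prop)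
  exact h.measurable.comp (measurable_pi_apply (⟨k, b⟩ : Σ k : Fin M, Fin (C.numGates k)))

theorem measurable_before : Measurable fun θ => C.before θ κ a :=
  measurable_lowProd a.2.le fun b _ => C.measurable_gate κ b

theorem measurable_after : Measurable fun θ => C.after θ κ a :=
  measurable_highProd a.2 fun b _ => C.measurable_gate κ b

theorem measurable_block (k : Fin M) : Measurable fun θ => C.block θ k := by
  have h : Measurable fun θ => highProd (C.gate θ k) 0 :=
    measurable_highProd (Nat.zero_le _) fun b _ => C.measurable_gate k b
  simp only [highProd, List.drop_zero] at h
  exact h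

theorem measurable_ext {Ω : Type*} {_ : MeasurableSpace Ω} {s : Finset (Fin N)}
    {V : Ω → QubitMatrix s} (hV : Measurable V) : Measurable fun ω => extendById s (V ω) :=
  (continuous_extendById s).measurable.comp hV

theorem measurable_extBlock (k : Fin M) : Measurable fun θ => C.extBlock θ k :=
  measurable_ext (C.measurable_block k)

theorem measurable_pieces (i : {k : Fin M // k ≠ κ} ⊕ Fin 3) : Measurable (C.pieces κ a i) := by
  match i with
  | .inl k => exact measurable_ext (C.measurable_block k)
  | .inr 0 => exact measurable_ext (C.measurable_before κ a)
  | .inr 1 => exact measurable_ext (C.measurable_gate κ a)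
  | .inr 2 => exact measurable_ext (C.measurable_after κ a)

theorem measurable_lowPart : Measurable (C.lowPart κ a) :=
  measurable_matrix_mul (measurable_ext (C.measurable_before κ a))
    (measurable_lowProd κ.2.le fun k _ => C.measurable_extBlock k)

theorem measurable_highPart : Measurable (C.highPart κ a) :=
  measurable_matrix_mul (measurable_matrix_mul
    (measurable_highProd κ.2 fun k _ => C.measurable_extBlock k)
    (measurable_ext (C.measurable_after κ a))) (measurable_ext (C.measurable_gate κ a))

theorem gate_mem_unitaryGroup (θ : C.Params) (k : Fin M) (b : Fin (C.numGates k)) :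
    C.gate θ k b ∈ Matrix.unitaryGroup (supp k → Fin 2) ℂ :=
  exp_neg_I_mem_unitaryGroup (C.gen_isHermitian k b) _

theorem before_mem_unitaryGroup (θ : C.Params) :
    C.before θ κ a ∈ Matrix.unitaryGroup (supp κ → Fin 2) ℂ :=
  lowProd_induction (p := (· ∈ Matrix.unitaryGroup (supp κ → Fin 2) ℂ)) (one_mem _)
    (fun _ _ => mul_mem) a.2.le fun b _ => C.gate_mem_unitaryGroup θ κ b

theorem after_mem_unitaryGroup (θ : C.Params) :
    C.after θ κ a ∈ Matrix.unitaryGroup (supp κ → Fin 2) ℂ :=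
  highProd_induction (p := (· ∈ Matrix.unitaryGroup (supp κ → Fin 2) ℂ)) (one_mem _)
    (fun _ _ => mul_mem) a.2 fun b _ => C.gate_mem_unitaryGroup θ κ b

theorem extBlock_mem_unitaryGroup (θ : C.Params) (k : Fin M) :
    C.extBlock θ k ∈ Matrix.unitaryGroup (Fin N → Fin 2) ℂ := by
  refine extendById_mem_unitaryGroup _ ?_
  have h := highProd_induction (f := C.gate θ k) (p := (· ∈ Matrix.unitaryGroup (supp k → Fin 2) ℂ))
    (one_mem _) (fun _ _ => mul_mem) (Nat.zero_le _) fun b _ => C.gate_mem_unitaryGroup θ k b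
  simp only [highProd, List.drop_zero] at h
  exact h

theorem lowProd_mem_unitaryGroup (θ : C.Params) {k : ℕ} (hk : k ≤ M) :
    lowProd (C.extBlock θ) k ∈ Matrix.unitaryGroup (Fin N → Fin 2) ℂ :=
  lowProd_induction (p := (· ∈ Matrix.unitaryGroup (Fin N → Fin 2) ℂ)) (one_mem _)
    (fun _ _ => mul_mem) hk fun k _ => C.extBlock_mem_unitaryGroup θ k

theorem highProd_mem_unitaryGroup (θ : C.Params) {k : ℕ} (hk : k ≤ M) :
    highProd (C.extBlock θ) k ∈ Matrix.unitaryGroup (Fin N → Fin 2) ℂ :=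
  highProd_induction (p := (· ∈ Matrix.unitaryGroup (Fin N → Fin 2) ℂ)) (one_mem _)
    (fun _ _ => mul_mem) hk fun k _ => C.extBlock_mem_unitaryGroup θ k

theorem lowPart_mem_unitaryGroup (θ : C.Params) :
    C.lowPart κ a θ ∈ Matrix.unitaryGroup (Fin N → Fin 2) ℂ :=
  mul_mem (extendById_mem_unitaryGroup _ (C.before_mem_unitaryGroup κ a θ))
    (C.lowProd_mem_unitaryGroup θ κ.2.le)

theorem highPart_mem_unitaryGroup (θ : C.Params) :
    C.highPart κ a θ ∈ Matrix.unitaryGroup (Fin N → Fin 2) ℂ :=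
  mul_mem (mul_mem (C.highProd_mem_unitaryGroup θ κ.2)
    (extendById_mem_unitaryGroup _ (C.after_mem_unitaryGroup κ a θ)))
    (extendById_mem_unitaryGroup _ (C.gate_mem_unitaryGroup θ κ a))

/-! ### Independence of the parts -/

section Independence

/-- The pieces that lie in the blocks before the block `k ≤ κ`. -/
def lowPieces (k : ℕ) : Set ({k : Fin M // k ≠ κ} ⊕ Fin 3) := Sum.inl '' {i | (i.1 : ℕ) < k}

/-- The pieces that lie in the blocks from the block `k > κ` on. -/
def highPieces (k : ℕ) : Set ({k : Fin M // k ≠ κ} ⊕ Fin 3) := Sum.inl '' {i | k ≤ (i.1 : ℕ)}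

theorem measurable_extBlock_of_mem {S : Set ({k : Fin M // k ≠ κ} ⊕ Fin 3)} {k : Fin M}
    (hk : k ≠ κ) (hS : Sum.inl ⟨k, hk⟩ ∈ S) :
    Measurable[⨆ i ∈ S, MeasurableSpace.comap (C.pieces κ a i) inferInstance]
      fun θ => C.extBlock θ k :=
  measurable_iSup_comap (C.pieces κ a) hS

theorem measurable_lowProd_of_subset {S : Set ({k : Fin M // k ≠ κ} ⊕ Fin 3)} {k : ℕ}
    (hk : k ≤ κ) (hS : lowPieces κ k ⊆ S) :
    Measurable[⨆ i ∈ S, MeasurableSpace.comap (C.pieces κ a i) inferInstance]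
      fun θ => lowProd (C.extBlock θ) k :=
  measurable_lowProd (hk.trans κ.2.le) fun i hi =>
    C.measurable_extBlock_of_mem κ a (by rintro rfl; omega) (hS ⟨⟨i, _⟩, hi, rfl⟩)

theorem measurable_highProd_of_subset {S : Set ({k : Fin M // k ≠ κ} ⊕ Fin 3)} {k : ℕ}
    (hk : κ < k) (hkM : k ≤ M) (hS : highPieces κ k ⊆ S) :
    Measurable[⨆ i ∈ S, MeasurableSpace.comap (C.pieces κ a i) inferInstance]
      fun θ => highProd (C.extBlock θ) k :=
  measurable_highProd hkM fun i hi =>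
    C.measurable_extBlock_of_mem κ a (by rintro rfl; omega) (hS ⟨⟨i, _⟩, hi, rfl⟩)

variable {P : Measure C.Params} (hindep : iIndepFun (C.pieces κ a) P)

include hindep

theorem indepFun_extBlock_lowProd (k : Fin M) (hk : k < κ) :
    IndepFun (fun θ => C.extBlock θ k) (fun θ => lowProd (C.extBlock θ) k) P := by
  refine indepFun_of_iIndepFun_of_disjoint hindep (C.measurable_pieces κ a)
    (S := {Sum.inl ⟨k, hk.ne⟩}) (T := lowPieces κ k) ?_
    (C.measurable_extBlock_of_mem κ a hk.ne (Set.mem_singleton _))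
    (C.measurable_lowProd_of_subset κ a hk.le subset_rfl)
  rw [Set.disjoint_singleton_left]
  rintro ⟨i, hi, h⟩
  rw [Sum.inl.injEq] at h
  rw [h] at hi
  exact lt_irrefl (k : ℕ) hi

theorem indepFun_highProd_extBlock (k : Fin M) (hk : κ < k) :
    IndepFun (fun θ => highProd (C.extBlock θ) (k + 1)) (fun θ => C.extBlock θ k) P := by
  refine indepFun_of_iIndepFun_of_disjoint hindep (C.measurable_pieces κ a)
    (S := highPieces κ (k + 1)) (T := {Sum.inl ⟨k, hk.ne'⟩}) ?_
    (C.measurable_highProd_of_subset κ a (Nat.lt_succ_of_lt hk) k.2 subset_rfl)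
    (C.measurable_extBlock_of_mem κ a hk.ne' (Set.mem_singleton _))
  rw [Set.disjoint_singleton_right]
  rintro ⟨i, hi, h⟩
  rw [Sum.inl.injEq] at h
  rw [h] at hi
  exact Nat.not_succ_le_self (k : ℕ) hi

theorem indepFun_before_lowProd :
    IndepFun (fun θ => extendById (supp κ) (C.before θ κ a))
      (fun θ => lowProd (C.extBlock θ) κ) P := by
  refine indepFun_of_iIndepFun_of_disjoint hindep (C.measurable_pieces κ a)
    (S := {Sum.inr 0}) (T := lowPieces κ κ) ?_
    (measurable_iSup_comap (C.pieces κ a) (i := Sum.inr 0) rfl)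
    (C.measurable_lowProd_of_subset κ a le_rfl subset_rfl)
  rw [Set.disjoint_singleton_left]
  rintro ⟨i, hi, h⟩
  exact Sum.inl_ne_inr h

theorem indepFun_highProd_after :
    IndepFun (fun θ => highProd (C.extBlock θ) (κ + 1))
      (fun θ => extendById (supp κ) (C.after θ κ a)) P := by
  refine indepFun_of_iIndepFun_of_disjoint hindep (C.measurable_pieces κ a)
    (S := highPieces κ (κ + 1)) (T := {Sum.inr 2}) ?_
    (C.measurable_highProd_of_subset κ a (Nat.lt_succ_self _) κ.2 subset_rfl)
    (measurable_iSup_comap (C.pieces κ a) (i := Sum.inr 2) rfl)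
  rw [Set.disjoint_singleton_right]
  rintro ⟨i, hi, h⟩
  exact Sum.inl_ne_inr h

theorem indepFun_highProd_mul_after_gate :
    IndepFun (fun θ => highProd (C.extBlock θ) (κ + 1) * extendById (supp κ) (C.after θ κ a))
      (fun θ => extendById (supp κ) (C.gate θ κ a)) P := by
  refine indepFun_of_iIndepFun_of_disjoint hindep (C.measurable_pieces κ a)
    (S := insert (Sum.inr 2) (highPieces κ (κ + 1))) (T := {Sum.inr 1}) ?_
    (measurable_matrix_mul
      (C.measurable_highProd_of_subset κ a (Nat.lt_succ_self _) κ.2 (Set.subset_insert _ _))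
      (measurable_iSup_comap (C.pieces κ a) (i := Sum.inr 2) (Set.mem_insert _ _)))
    (measurable_iSup_comap (C.pieces κ a) (i := Sum.inr 1) rfl)
  rw [Set.disjoint_singleton_right]
  rintro (h | ⟨i, hi, h⟩)
  · simp at h
  · exact Sum.inl_ne_inr h

theorem indepFun_highPart_lowPart : IndepFun (C.highPart κ a) (C.lowPart κ a) P := by
  refine indepFun_of_iIndepFun_of_disjoint hindep (C.measurable_pieces κ a)
    (S := insert (Sum.inr 1) (insert (Sum.inr 2) (highPieces κ (κ + 1))))
    (T := insert (Sum.inr 0) (lowPieces κ κ)) ?_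
    (measurable_matrix_mul (measurable_matrix_mul
      (C.measurable_highProd_of_subset κ a (Nat.lt_succ_self _) κ.2
        ((Set.subset_insert _ _).trans (Set.subset_insert _ _)))
      (measurable_iSup_comap (C.pieces κ a) (i := Sum.inr 2)
        (Set.mem_insert_of_mem _ (Set.mem_insert _ _))))
      (measurable_iSup_comap (C.pieces κ a) (i := Sum.inr 1) (Set.mem_insert _ _)))
    (measurable_matrix_mul
      (measurable_iSup_comap (C.pieces κ a) (i := Sum.inr 0) (Set.mem_insert _ _))
      (C.measurable_lowProd_of_subset κ a le_rfl (Set.subset_insert _ _)))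
  rw [Set.disjoint_left]
  rintro x (rfl | rfl | ⟨i, hi, rfl⟩) (h | ⟨j, hj, h⟩)
  · simp at h
  · exact Sum.inl_ne_inr h
  · simp at h
  · exact Sum.inl_ne_inr h
  · exact Sum.inl_ne_inr h
  · rw [Sum.inl.injEq] at h
    rw [h] at hj
    have h1 : (κ : ℕ) + 1 ≤ i.1 := hi
    have h2 : (i.1 : ℕ) < κ := hj
    omega

end Independence

/-! ### Expectations over the circuit -/

section Expectation

variable (P : Measure C.Params)

/-- The channel of block `k`, where a linear map `D` is inserted before the gate `a` of block `κ`. -/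
def blockChannel
    (D : Matrix ((Fin N → Fin 2) × (Fin N → Fin 2)) ((Fin N → Fin 2) × (Fin N → Fin 2)) ℂ →ₗ[ℂ]
      Matrix ((Fin N → Fin 2) × (Fin N → Fin 2)) ((Fin N → Fin 2) × (Fin N → Fin 2)) ℂ) (k : ℕ) :
    Matrix ((Fin N → Fin 2) × (Fin N → Fin 2)) ((Fin N → Fin 2) × (Fin N → Fin 2)) ℂ →ₗ[ℂ]
      Matrix ((Fin N → Fin 2) × (Fin N → Fin 2)) ((Fin N → Fin 2) × (Fin N → Fin 2)) ℂ :=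
  if hk : k < M then
    if k = κ then
      twirl P (fun θ => extendById (supp κ) (C.before θ κ a)) ∘ₗ D ∘ₗ
        twirl P (fun θ => extendById (supp κ) (C.gate θ κ a)) ∘ₗ
          twirl P fun θ => extendById (supp κ) (C.after θ κ a)
    else twirl P fun θ => C.extBlock θ ⟨k, hk⟩
  -- A default value: `channelValue` at `M` uses only indices below `M`.
  else LinearMap.id

theorem blockChannel_self (D) :
    C.blockChannel κ a P D κ
      = twirl P (fun θ => extendById (supp κ) (C.before θ κ a)) ∘ₗ D ∘ₗ
        twirl P (fun θ => extendById (supp κ) (C.gate θ κ a)) ∘ₗ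
          twirl P fun θ => extendById (supp κ) (C.after θ κ a) := by
  rw [blockChannel, dif_pos κ.2, if_pos rfl]

theorem blockChannel_of_ne (D) {k : ℕ} (hk : k < M) (hkκ : k ≠ κ) :
    C.blockChannel κ a P D k = twirl P fun θ => C.extBlock θ ⟨k, hk⟩ := by
  rw [blockChannel, dif_pos hk, if_neg hkκ]

variable [IsProbabilityMeasure P] (hindep : iIndepFun (C.pieces κ a) P)

include hindep

/-- Below the cut, independence merges the block channels into the twirl of their product; `D` does
not enter. -/
theorem channelValue_of_le (D) (k : ℕ) (hk : k ≤ κ) (A) :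
    channelValue (C.blockChannel κ a P D) k A
      = twirl P (fun θ => lowProd (C.extBlock θ) k) A
        ((fun _ => 0), fun _ => 0) ((fun _ => 0), fun _ => 0) := by
  have hκ := κ.2
  induction k generalizing A with
  | zero =>
    rw [twirl_eq_of_forall (A := A) (B := A)
      (measurable_lowProd (Nat.zero_le _) fun k _ => C.measurable_extBlock k)
      (fun θ => C.lowProd_mem_unitaryGroup θ (Nat.zero_le _))
      (fun θ => by simp [lowProd_zero, doubleConj])]
    rfl
  | succ k ih =>
    have hkM : k < M := by omega
    rw [channelValue, LinearMap.comp_apply, ih (by omega),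
      C.blockChannel_of_ne κ a P D hkM (by omega)]
    simp only [lowProd_succ _ hkM]
    rw [twirl_mul (C.measurable_extBlock _) (fun θ => C.extBlock_mem_unitaryGroup θ _)
      (measurable_lowProd hkM.le fun k _ => C.measurable_extBlock k)
      (fun θ => C.lowProd_mem_unitaryGroup θ hkM.le)
      (C.indepFun_extBlock_lowProd κ a hindep ⟨k, hkM⟩ hk)]
    exact measurable_matrix_mul (C.measurable_extBlock _)
      (measurable_lowProd hkM.le fun k _ => C.measurable_extBlock k)

/-- The counterpart above the cut, peeling off blocks from the last one downwards. -/
theorem channelValue_highProd (D) {k : ℕ} (hk : κ < k) (hkM : k ≤ M) (A) :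
    channelValue (C.blockChannel κ a P D) k (twirl P (fun θ => highProd (C.extBlock θ) k) A)
      = channelValue (C.blockChannel κ a P D) M A := by
  induction hkM using Nat.decreasingInduction with
  | self =>
    rw [twirl_eq_of_forall (A := A) (B := A)
      (measurable_highProd le_rfl fun k _ => C.measurable_extBlock k)
      (fun θ => C.highProd_mem_unitaryGroup θ le_rfl)
      (fun θ => by simp [highProd_self, doubleConj])]
  | of_succ k hkM ih =>
    rw [← ih (by omega), channelValue, LinearMap.comp_apply,
      C.blockChannel_of_ne κ a P D hkM (by omega)]
    simp only [highProd_eq _ hkM]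
    rw [twirl_mul (measurable_highProd hkM fun k _ => C.measurable_extBlock k)
      (fun θ => C.highProd_mem_unitaryGroup θ hkM)
      (C.measurable_extBlock _) (fun θ => C.extBlock_mem_unitaryGroup θ _)
      (C.indepFun_highProd_extBlock κ a hindep ⟨k, hkM⟩ hk)]
    exact measurable_matrix_mul (measurable_highProd hkM fun k _ => C.measurable_extBlock k)
      (C.measurable_extBlock _)

/-- The expectation over the circuit factors into the channels of its blocks. -/
theorem integral_eq_channelValue (D) (A) :
    ∫ θ, doubleConj (C.lowPart κ a θ) (D (doubleConj (C.highPart κ a θ) A))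
        ((fun _ => 0), fun _ => 0) ((fun _ => 0), fun _ => 0) ∂P
      = channelValue (C.blockChannel κ a P D) M A := by
  have hB := measurable_ext (C.measurable_before κ a)
  have hA := measurable_ext (C.measurable_after κ a)
  have hG := measurable_ext (C.measurable_gate κ a)
  have hl : Measurable fun θ => lowProd (C.extBlock θ) κ :=
    measurable_lowProd κ.2.le fun k _ => C.measurable_extBlock k
  have hh : Measurable fun θ => highProd (C.extBlock θ) (κ + 1) :=
    measurable_highProd κ.2 fun k _ => C.measurable_extBlock k
  have hBu := fun θ => extendById_mem_unitaryGroup _ (C.before_mem_unitaryGroup κ a θ)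
  have hAu := fun θ => extendById_mem_unitaryGroup _ (C.after_mem_unitaryGroup κ a θ)
  have hGu := fun θ => extendById_mem_unitaryGroup _ (C.gate_mem_unitaryGroup θ κ a)
  have hlu := fun θ => C.lowProd_mem_unitaryGroup θ κ.2.le
  have hhu := fun θ => C.highProd_mem_unitaryGroup θ (k := κ + 1) κ.2
  have h1 : ∀ X, twirl P (C.lowPart κ a) X = twirl P (fun θ => lowProd (C.extBlock θ) κ)
      (twirl P (fun θ => extendById (supp κ) (C.before θ κ a)) X) := fun X =>
    twirl_mul hB hBu hl hlu (C.indepFun_before_lowProd κ a hindep) (C.measurable_lowPart κ a) X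
  have h2 : twirl P (C.highPart κ a) A
      = twirl P (fun θ => extendById (supp κ) (C.gate θ κ a))
        (twirl P (fun θ => extendById (supp κ) (C.after θ κ a))
          (twirl P (fun θ => highProd (C.extBlock θ) (κ + 1)) A)) := by
    have h3 := twirl_mul (measurable_matrix_mul hh hA) (fun θ => mul_mem (hhu θ) (hAu θ)) hG hGu
      (C.indepFun_highProd_mul_after_gate κ a hindep) (C.measurable_highPart κ a) A
    rw [twirl_mul hh hhu hA hAu (C.indepFun_highProd_after κ a hindep)
      (measurable_matrix_mul hh hA)] at h3
    exact h3
  rw [integral_doubleConj_comp (C.measurable_highPart κ a) (C.highPart_mem_unitaryGroup κ a)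
    (C.measurable_lowPart κ a) (C.lowPart_mem_unitaryGroup κ a)
    (C.indepFun_highPart_lowPart κ a hindep), h1, h2,
    ← C.channelValue_of_le κ a P hindep D κ le_rfl,
    ← C.channelValue_highProd κ a P hindep D (Nat.lt_succ_self _) κ.2, channelValue,
    LinearMap.comp_apply, C.blockChannel_self]
  rfl

end Expectation

end BlockCircuit

/-! ### Mean and second moment of the derivative -/

namespace BlockCircuit

variable {N M : ℕ} {supp : Fin M → Finset (Fin N)} (C : BlockCircuit supp)
  (κ : Fin M) (a : Fin (C.numGates κ)) {H : QubitMatrix (Fin N)}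

/-- The Heisenberg-picture entry whose real part is the derivative of the cost is real. -/
theorem ofReal_costDeriv (hH : H.IsHermitian) (θ : C.Params) :
    (C.costDeriv H κ a θ : ℂ) = ((C.lowPart κ a θ)ᴴ *
      commutatorMap (extendById (supp κ) (C.gen κ a))
        ((C.highPart κ a θ)ᴴ * H * C.highPart κ a θ) * C.lowPart κ a θ)
      (fun _ => 0) (fun _ => 0) := by
  rw [costDeriv_eq]
  set G := extendById (supp κ) (C.gen κ a) with hG
  have hGs : Gᴴ = G := by rw [hG, extendById_conjTranspose, (C.gen_isHermitian κ a).eq]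
  set X := (C.highPart κ a θ)ᴴ * H * C.highPart κ a θ with hX
  have hXs : Xᴴ = X := by
    rw [hX]
    simp only [Matrix.conjTranspose_mul, Matrix.conjTranspose_conjTranspose, hH.eq,
      Matrix.mul_assoc]
  have hK : (commutatorMap G X)ᴴ = commutatorMap G X := by
    rw [commutatorMap_apply, Matrix.conjTranspose_smul, Matrix.conjTranspose_sub,
      Matrix.conjTranspose_mul G X, Matrix.conjTranspose_mul X G, hGs, hXs, Complex.star_def,
      Complex.conj_I, neg_smul, ← smul_neg, neg_sub]
  set Y := (C.lowPart κ a θ)ᴴ * commutatorMap G X * C.lowPart κ a θ with hY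
  have hYs : Yᴴ = Y := by
    rw [hY]
    simp only [Matrix.conjTranspose_mul, Matrix.conjTranspose_conjTranspose, hK, Matrix.mul_assoc]
  have h := congrFun (congrFun hYs fun _ => 0) fun _ => 0
  rw [Matrix.conjTranspose_apply] at h
  exact Complex.conj_eq_iff_re.mp h

/-- The identity on the second copy is inert, so the first moment is handled by the same two-copy
channels as the second. -/
theorem ofReal_costDeriv_eq_doubleConj (hH : H.IsHermitian) (θ : C.Params) :
    (C.costDeriv H κ a θ : ℂ) = doubleConj (C.lowPart κ a θ)
      (commutatorMap (extendById (supp κ) (C.gen κ a) ⊗ₖ 1)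
        (doubleConj (C.highPart κ a θ) (H ⊗ₖ 1)))
      ((fun _ => 0), fun _ => 0) ((fun _ => 0), fun _ => 0) := by
  have hu : ∀ {V : QubitMatrix (Fin N)}, V ∈ Matrix.unitaryGroup (Fin N → Fin 2) ℂ →
      Vᴴ * 1 * V = 1 := fun hV => by
    rw [Matrix.mul_one]
    exact Matrix.mem_unitaryGroup_iff'.mp hV
  rw [doubleConj_kronecker, hu (C.highPart_mem_unitaryGroup κ a θ), commutatorMap_fst_kronecker,
    doubleConj_kronecker, hu (C.lowPart_mem_unitaryGroup κ a θ), Matrix.kroneckerMap_apply,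
    Matrix.one_apply_eq, mul_one, C.ofReal_costDeriv κ a hH]

theorem ofReal_costDeriv_sq_eq_doubleConj (hH : H.IsHermitian) (θ : C.Params) :
    ((C.costDeriv H κ a θ ^ 2 : ℝ) : ℂ) = doubleConj (C.lowPart κ a θ)
      (doubleCommutator (extendById (supp κ) (C.gen κ a))
        (doubleConj (C.highPart κ a θ) (H ⊗ₖ H)))
      ((fun _ => 0), fun _ => 0) ((fun _ => 0), fun _ => 0) := by
  rw [doubleConj_kronecker, doubleCommutator_kronecker, doubleConj_kronecker,
    Matrix.kroneckerMap_apply, Complex.ofReal_pow, C.ofReal_costDeriv κ a hH, sq]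

theorem measurable_costDeriv (H : QubitMatrix (Fin N)) : Measurable (C.costDeriv H κ a) := by
  have hconj : Continuous fun V : QubitMatrix (Fin N) => Vᴴ := continuous_id.matrix_conjTranspose
  have hcomm : Continuous fun X : QubitMatrix (Fin N) =>
      commutatorMap (extendById (supp κ) (C.gen κ a)) X := by
    simp only [commutatorMap_apply]
    fun_prop
  have hentry : Continuous fun V : QubitMatrix (Fin N) => (V (fun _ => 0) (fun _ => 0)).re := by
    fun_prop
  have hl := C.measurable_lowPart κ a
  have hh := C.measurable_highPart κ a
  have h := hentry.measurable.comp (measurable_matrix_mul (measurable_matrix_mul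
    (hconj.measurable.comp hl) (hcomm.measurable.comp (measurable_matrix_mul
      (measurable_matrix_mul (hconj.measurable.comp hh) (measurable_const (a := H))) hh))) hl)
  have he : C.costDeriv H κ a = _ := funext fun θ => C.costDeriv_eq κ a H θ
  rw [he]
  exact h

section Moments

variable {J : Type*} [Fintype J] (coeff : J → ℝ) (h : J → Fin N → Pauli)

theorem isHermitian_sum_pauliString :
    (∑ j, (coeff j : ℂ) • pauliString (h j)).IsHermitian := by
  rw [Matrix.IsHermitian, Matrix.conjTranspose_sum]
  refine Finset.sum_congr rfl fun j _ => ?_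
  rw [Matrix.conjTranspose_smul, pauliString_conjTranspose, Complex.star_def, Complex.conj_ofReal]

theorem sum_smul_kronecker {m : Type*} (A : J → Matrix m m ℂ) (B : Matrix m m ℂ) :
    (∑ j, (coeff j : ℂ) • A j) ⊗ₖ B = ∑ j, (coeff j : ℂ) • (A j ⊗ₖ B) := by
  ext x y
  simp [Matrix.sum_apply, Finset.sum_mul, mul_assoc]

theorem kronecker_sum_smul {m : Type*} (A : J → Matrix m m ℂ) (B : Matrix m m ℂ) :
    B ⊗ₖ (∑ j, (coeff j : ℂ) • A j) = ∑ j, (coeff j : ℂ) • (B ⊗ₖ A j) := by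
  ext x y
  simp only [Matrix.sum_apply, Matrix.kroneckerMap_apply, Matrix.smul_apply, Finset.mul_sum,
    smul_eq_mul]
  exact Finset.sum_congr rfl fun j _ => by ring

variable {P : Measure C.Params} [IsProbabilityMeasure P] (hindep : iIndepFun (C.pieces κ a) P)

include hindep

/-- The derivative of the cost has mean zero. -/
theorem integral_costDeriv (hblock : ∀ k, k ≠ κ → IsTwoDesign P fun θ => C.block θ k)
    (hafter : IsTwoDesign P fun θ => C.after θ κ a) :
    ∫ θ, C.costDeriv (∑ j, (coeff j : ℂ) • pauliString (h j)) κ a θ ∂P = 0 := by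
  set D := commutatorMap (extendById (supp κ) (C.gen κ a) ⊗ₖ (1 : QubitMatrix (Fin N))) with hD
  -- A block behind κ either preserves or annihilates a string paired with the identity, so nothing
  -- is lost on the way down to block κ, where the commutator vanishes on average.
  have hzero : ∀ k : ℕ, κ < k → k ≤ M → ∀ p : Fin N → Pauli,
      channelValue (C.blockChannel κ a P D) k (pauliString p ⊗ₖ 1) = 0 := by
    intro k hk
    induction k, hk using Nat.le_induction with
    | base =>
      intro _ p
      rw [channelValue, LinearMap.comp_apply, blockChannel_self]
      simp only [LinearMap.comp_apply]
      rw [hD, commutator_of_cut (fun θ => C.gate_mem_unitaryGroup θ κ a) (C.measurable_gate κ a)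
        hafter (C.measurable_after κ a), map_zero, map_zero]
    | succ k hk ih =>
      intro hkM p
      have hne : k ≠ κ := by
        have : (κ : ℕ) + 1 ≤ k := hk
        omega
      have hb := hblock ⟨k, hkM⟩ fun e => hne (congrArg Fin.val e)
      rw [channelValue, LinearMap.comp_apply, C.blockChannel_of_ne κ a P D hkM hne]
      have h1 := hb.twirl_pauliString_one (C.measurable_block _) p
      have h2 : twirl P (fun θ => C.extBlock θ ⟨k, hkM⟩) (pauliString p ⊗ₖ 1) = _ := h1
      rw [h2]
      split_ifs
      · exact ih (by omega) p
      · exact map_zero _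
  have h1 := C.integral_eq_channelValue κ a P hindep D
    ((∑ j, (coeff j : ℂ) • pauliString (h j)) ⊗ₖ 1)
  simp only [hD, ← C.ofReal_costDeriv_eq_doubleConj κ a (isHermitian_sum_pauliString coeff h)] at h1
  rw [integral_complex_ofReal, sum_smul_kronecker, map_sum, ← hD] at h1
  refine Complex.ofReal_eq_zero.mp (h1.trans (Finset.sum_eq_zero fun j _ => ?_))
  rw [map_smul, hzero M κ.2 le_rfl, smul_zero]

/-- The second moment of the derivative of the cost, in terms of pairs of Pauli strings. -/
theorem integral_costDeriv_sq :
    ∫ θ, C.costDeriv (∑ j, (coeff j : ℂ) • pauliString (h j)) κ a θ ^ 2 ∂P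
      = ∑ i, ∑ j, coeff i * coeff j * (channelValue (C.blockChannel κ a P
          (doubleCommutator (extendById (supp κ) (C.gen κ a)))) M
            (pauliString (h i) ⊗ₖ pauliString (h j))).re := by
  have h1 := C.integral_eq_channelValue κ a P hindep
    (doubleCommutator (extendById (supp κ) (C.gen κ a)))
    ((∑ j, (coeff j : ℂ) • pauliString (h j)) ⊗ₖ ∑ j, (coeff j : ℂ) • pauliString (h j))
  simp only [← C.ofReal_costDeriv_sq_eq_doubleConj κ a (isHermitian_sum_pauliString coeff h)] at h1
  rw [integral_complex_ofReal] at h1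
  rw [← Complex.ofReal_re (∫ θ, _ ∂P), h1, sum_smul_kronecker, map_sum, Complex.re_sum]
  refine Finset.sum_congr rfl fun i _ => ?_
  rw [map_smul, smul_eq_mul, Complex.re_ofReal_mul, kronecker_sum_smul, map_sum, Complex.re_sum,
    Finset.mul_sum]
  refine Finset.sum_congr rfl fun j _ => ?_
  rw [map_smul, smul_eq_mul, Complex.re_ofReal_mul, mul_assoc]

end Moments

end BlockCircuit

/-! ### Assembly of the bound -/

theorem card_ladder {N M β : ℕ} (hN : M + β ≤ N + 1) (k : Fin M) :
    (ladder N M β k).card = β := by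
  have hk := k.2
  have h : (ladder N M β k).map Fin.valEmbedding = Finset.Ico (k : ℕ) (k + β) := by
    ext i
    simp only [Finset.mem_map, mem_ladder, Fin.valEmbedding_apply, Finset.mem_Ico]
    constructor
    · rintro ⟨j, hj, rfl⟩
      exact hj
    · intro hi
      exact ⟨⟨i, by omega⟩, hi, rfl⟩
  rw [← Finset.card_map Fin.valEmbedding, h, Nat.card_Ico, Nat.add_sub_cancel_left]

/-- The hypothesis `l ≤ k` makes the truncated subtraction agree with the integer one. -/
theorem zpow_eq_two_mul_inv_pow (β k l r : ℕ) (hkl : l ≤ k) :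
    (2 : ℝ) ^ (1 - 2 * (β : ℤ) * ((k : ℤ) - (l : ℤ) + (r : ℤ)))
      = 2 * (((4 : ℝ) ^ β)⁻¹) ^ (k - l + r) := by
  have h : (1 - 2 * (β : ℤ) * ((k : ℤ) - (l : ℤ) + (r : ℤ)))
      = 1 + -((2 * β * (k - l + r) : ℕ) : ℤ) := by
    push_cast [Nat.cast_sub hkl]
    ring
  rw [h, zpow_add₀ two_ne_zero, zpow_one, zpow_neg, zpow_natCast, pow_mul, pow_mul, inv_pow]
  norm_num

end

theorem mainTheorem3 {N M β r : ℕ} (hβ : 2 ≤ β) (hN : M + β ≤ N + 1)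
    -- the ladder circuit, and the law of its randomly initialized parameters
    (C : BlockCircuit (ladder N M β)) (P : Measure C.Params) [IsProbabilityMeasure P]
    -- the differential gate, number `a` in block `κ`; its generator is a non-trivial Pauli string
    (κ : Fin M) (a : Fin (C.numGates κ))
    (hΩ : ∃ p : ladder N M β κ → Pauli, p ≠ (fun _ => Pauli.I) ∧ C.gen κ a = pauliString p)
    -- independent local 2-designs, with the differential gate sandwiched by two of them
    (hblock : ∀ k, k ≠ κ → IsTwoDesign P (fun θ => C.block θ k))
    (hbefore : IsTwoDesign P (fun θ => C.before θ κ a))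
    (hafter : IsTwoDesign P (fun θ => C.after θ κ a))
    (hindep : iIndepFun (C.pieces κ a) P)
    -- the Pauli decomposition of the `r`-local Hamiltonian
    {J : Type*} [Fintype J] (coeff : J → ℝ) (h : J → Fin N → Pauli)
    (h_inj : Function.Injective h) (h_nontrivial : ∀ j, h j ≠ fun _ => Pauli.I)
    (h_local : ∀ j, (pauliSupport (h j)).card ≤ r)
    (h_supp : ∀ j, pauliSupport (h j) ⊆ Finset.univ.biUnion (ladder N M β))
    -- `k' j` is the last block that acts on the support of `h j`
    (k' : J → Fin M)
    (hk' : ∀ j, IsGreatest {k | (ladder N M β k ∩ pauliSupport (h j)).Nonempty} (k' j)) :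
    ∑ j with κ ≤ k' j,
        coeff j ^ 2 * (2 : ℝ) ^ (1 - 2 * (β : ℤ) * (((k' j : ℕ) : ℤ) - ((κ : ℕ) : ℤ) + (r : ℤ)))
      ≤ variance (C.costDeriv (∑ j, (coeff j : ℂ) • pauliString (h j)) κ a) P := by
  obtain ⟨g, hg, hgen⟩ := hΩ
  rw [variance_of_integral_eq_zero (C.measurable_costDeriv κ a _).aemeasurable
    (C.integral_costDeriv κ a coeff h hindep hblock hafter),
    C.integral_costDeriv_sq κ a coeff h hindep]
  -- A common lower bound for the mixing weights, slightly below the exact 1/(4^β - 1); it gives the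
  -- clean power of 2.
  set w : ℝ := ((4 : ℝ) ^ β)⁻¹ with hw
  have h4 : (4 : ℝ) ≤ 4 ^ β := by
    calc (4 : ℝ) = 4 ^ 1 := (pow_one _).symm
      _ ≤ 4 ^ β := pow_le_pow_right₀ (by norm_num) (by omega)
  set Φ := C.blockChannel κ a P (doubleCommutator (extendById (ladder N M β κ) (C.gen κ a)))
    with hΦ
  set e : Fin M → ℝ := fun k => if k = κ then 0 else 1 with he
  set c : Fin M → ℝ := fun k =>
    if k = κ then 2 * (4 : ℝ) ^ β / ((4 : ℝ) ^ β - 1) * ((4 : ℝ) ^ β - 1)⁻¹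
    else ((4 : ℝ) ^ β - 1)⁻¹ with hc
  have hmix : ∀ k : Fin M, IsPauliMixing (ladder N M β k) (e k) (c k) (Φ k) := by
    intro k
    by_cases hk : k = κ
    · subst hk
      rw [hΦ, C.blockChannel_self, hgen]
      have h1 := isPauliMixing_of_cut hbefore (C.measurable_before k a)
        (fun θ => C.gate_mem_unitaryGroup θ k a) (C.measurable_gate k a) hafter
        (C.measurable_after k a) hg
      rw [card_ladder hN] at h1
      simpa only [he, hc, if_pos] using h1
    · rw [hΦ, C.blockChannel_of_ne κ a P _ k.2 fun h => hk (Fin.ext h)]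
      have h1 := (hblock k hk).isPauliMixing (C.measurable_block k)
      rw [card_ladder hN] at h1
      simp only [he, hc, if_neg hk]
      exact h1
  have hF := ladderValue_channelValue hmix
  have he0 : ∀ k, 0 ≤ e k := fun k => by simp only [he]; split_ifs <;> norm_num
  have he1 : ∀ k, k ≠ κ → e k = 1 := fun k hk => if_neg hk
  have hw0 : 0 ≤ w := by positivity
  have hw1 : w ≤ 1 := inv_le_one_of_one_le₀ (by linarith)
  have hinv : w ≤ ((4 : ℝ) ^ β - 1)⁻¹ := inv_anti₀ (by linarith) (by linarith)
  have hcκ : 2 * w ≤ c κ := by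
    simp only [hc, if_true]
    -- Here 2·4^β/(4^β - 1) ≥ 2, and the remaining factor is at least `w`.
    refine mul_le_mul ?_ hinv hw0 (div_nonneg (by positivity) (by linarith))
    rw [le_div_iff₀ (by linarith)]
    linarith
  have hcw : ∀ k, w ≤ c k := fun k => by
    by_cases hk : k = κ
    · rw [hk]; linarith
    · simpa only [hc, if_neg hk] using hinv
  -- Distinct strings differ at a qubit where one of them is not the identity; by `h_supp` some
  -- block covers that qubit.
  have hoff : ∀ i j, i ≠ j → (channelValue Φ M (pauliString (h i) ⊗ₖ pauliString (h j))).re = 0 := by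
    intro i j hij
    refine hF.eq_zero_of_ne M le_rfl (h i) (h j) ?_
    obtain ⟨q, hq⟩ := Function.ne_iff.mp (h_inj.ne hij)
    refine ⟨q, ?_, hq⟩
    have hq' : q ∈ Finset.univ.biUnion (ladder N M β) := by
      by_cases hqi : h i q = .I
      · exact h_supp j (by simpa [pauliSupport] using fun hqj => hq (hqi.trans hqj.symm))
      · exact h_supp i (by simpa [pauliSupport] using hqi)
    obtain ⟨k, -, hk⟩ := Finset.mem_biUnion.mp hq'
    exact mem_ladderBelow.mpr ⟨k, k.2, hk⟩
  have hdiag : ∀ i, ∑ j, coeff i * coeff j *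
      (channelValue Φ M (pauliString (h i) ⊗ₖ pauliString (h j))).re
      = coeff i ^ 2 * (channelValue Φ M (pauliString (h i) ⊗ₖ pauliString (h i))).re := by
    intro i
    rw [Finset.sum_eq_single i (fun j _ hj => by rw [hoff i j hj.symm, mul_zero]) (by simp), sq]
  simp only [hdiag]
  -- Terms whose last block precedes κ are dropped; nonnegativity of the diagonal values suffices
  -- for this.
  refine le_trans (Finset.sum_le_sum fun j hj => ?_)
    (Finset.sum_le_sum_of_subset_of_nonneg (Finset.filter_subset _ _) fun j _ _ =>
      mul_nonneg (sq_nonneg _)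
        (hF.nonneg he0 (fun k => hw0.trans (hcw k)) M le_rfl (h j)))
  have hκ : κ ≤ k' j := (Finset.mem_filter.mp hj).2
  refine mul_le_mul_of_nonneg_left ?_ (sq_nonneg _)
  rw [zpow_eq_two_mul_inv_pow β (k' j) κ r hκ]
  exact hF.two_mul_pow_le he0 hβ hN he1 hw0 hw1 hcw hcκ (h j) (h_local j) (h_supp j) (k' j) (hk' j) hκ
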